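/- Fix $d\ge 1$. For each $n\ge1$ let $\varepsilon_{1,n},\dots,\varepsilon_{n,n}$ be real random variables and let $\mathbf X_{0,n}=[X_{0,n},X_{-1,n},\dots,X_{-d+1,n}]^T$ be a random vector of $\mathbb R^d$, all on one probability space. For $\boldsymbol\theta=(\theta_1,\dots,\theta_d)^T:[0,1]\to\mathbb R^d$ and $\sigma:[0,1]\to\mathbb R$, let $$X_{k,n}=\sum_{i=1}^d\theta_i\big(\tfrac{k-1}{n}\big)X_{k-i,n}+\sigma\big(\tfrac kn\big)\varepsilon_{k,n},\qquad k=1,\dots,n,$$ and write $\mathbb E_{\boldsymbol\theta,\sigma}$ for the expectation of functions of $(\mathbf X_{0,n},X_{1,n},\dots,X_{n,n})$ so defined (the variables $\varepsilon_{k,n}$ and $\mathbf X_{0,n}$ do not depend on $(\boldsymbol\theta,\sigma)$). Assume (A1) with $q=2$: for all $n\ge1$, the variables $\varepsilon_{k,n}$, $1\le k\le n$, are independent, have zero mean and unit variance, and are jointly independent of $\mathbf X_{0,n}$; moreover $\sup_{n\ge1}\mathbb E|\mathbf X_{0,n}|^2<\infty$ and $\sup_{1\le k\le n}\mathbb E|\varepsilon_{k,n}|^2<\infty$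 (supremum over all $n\geq 1$ and $1\leq k\leq n$). (A2): for all $1\le k\le n$, $\varepsilon_{k,n}$ has a density $p_{k,n}$ with respect to Lebesgue measure that is absolutely continuous on compact intervals and whose derivative $\dot p_{k,n}$ satisfies $$\mathbb E\Big[\frac{\dot p_{k,n}}{p_{k,n}}(\varepsilon_{k,n})\Big]=0\quad\text{and}\quad \sup_{1\le k\le n}\mathbb E\Big[\Big(\frac{\dot p_{k,n}}{p_{k,n}}(\varepsilon_{k,n})\Big)^2\Big]<\infty$$ (supremum over all $n\ge1$ and $1\le k\le n$). For $\beta>0$ write $\beta=m+a$ with $m\in\mathbb N=\{0,1,\dots\}$, $a\in(0,1]$. Let $\mathcal C(\beta,L,\rho,\sigma_-,\sigma_+)$ be the set of pairs $(\boldsymbol\theta,\sigma)$ with $\sigma:[0,1]\to[\sigma_-,\sigma_+]$ and $\boldsymbol\theta:[0,1]\to\mathbb R^d$ $m$ times differentiable such that $|\boldsymbol\theta^{(m)}(t)-\boldsymbol\theta^{(m)}(s)|\le L|t-s|^a$ for all $s,t\in[0,1]$, $\sup_{t\in[0,1]}|\boldsymbol\theta(t)|\le L$, and $1-\sum_{j=1}^d\theta_j(t)z^j\ne0$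 for all $t\in[0,1]$ and all $z\in\mathbb C$ with $|z|<\rho^{-1}$. Let $\beta>0$, $L>0$, $\rho\in(0,1)$ and $0<\sigma_-\le\sigma_+<\infty$, and put $\mathcal C=\mathcal C(\beta,L,\rho,\sigma_-,\sigma_+)$. Then there exists $\alpha>0$ such that for all $n\ge1$, all $t\in[0,1]$ and all estimators (measurable functions) $\hat{\boldsymbol\delta}_n=\hat{\boldsymbol\delta}_n(\mathbf X_{0,n},X_{1,n},\dots,X_{n,n})\in\mathbb R^d$, $$\inf_{\mathbf u\in\mathbb R^d,\,|\mathbf u|=1}\ \sup_{(\boldsymbol\theta,\sigma)\in\mathcal C}\ \mathbf u^T\,\mathrm{MSEM}_{\boldsymbol\theta,\sigma}(\hat{\boldsymbol\delta}_n,t)\,\mathbf u\ \ge\ \alpha\,n^{-2\beta/(1+2\beta)},$$ where $\mathrm{MSEM}_{\boldsymbol\theta,\sigma}(\hat{\boldsymbol\delta}_n,t)=\mathbb E_{\boldsymbol\theta,\sigma}\big[(\hat{\boldsymbol\delta}_n-\boldsymbol\theta(t))(\hat{\boldsymbol\delta}_n-\boldsymbol\theta(t))^T\big]$, and $\mathbf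 u^T\mathrm{MSEM}\,\mathbf u$ is read as $\mathbb E_{\boldsymbol\theta,\sigma}[(\mathbf u^T(\hat{\boldsymbol\delta}_n-\boldsymbol\theta(t)))^2]\in[0,\infty]$. -/

import Mathlib

open MeasureTheory ProbabilityTheory
open scoped ENNReal

noncomputable section

namespace TVAR

/-- The vector `[y, x₁, …, x_{d-1}]` obtained from `x = [x₁, …, x_d]` by inserting the newest value
`y` in front and dropping the oldest one. -/
def push {d : ℕ} (y : ℝ) (x : EuclideanSpace ℝ (Fin d)) : EuclideanSpace ℝ (Fin d) :=
  WithLp.toLp 2 fun i => if (i : ℕ) = 0 then y else x ⟨(i : ℕ) - 1, by omega⟩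

/-- The vector `𝐗_{k,n} = [X_{k,n}, X_{k-1,n}, …, X_{k-d+1,n}]` of the time-varying autoregression
`X_{k,n} = ∑ᵢ θᵢ((k-1)/n) X_{k-i,n} + σ(k/n) ε_{k,n}`, `k ≥ 1`, with initial conditions
`𝐗_{0,n} = x₀` and innovations `e k = ε_{k,n}`. The coordinate of index `i` in `Fin d` is the one
numbered `i + 1` in the formula. -/
def state {d : ℕ} (θ : ℝ → EuclideanSpace ℝ (Fin d)) (σ : ℝ → ℝ) (n : ℕ)
    (x₀ : EuclideanSpace ℝ (Fin d)) (e : ℕ → ℝ) : ℕ → EuclideanSpace ℝ (Fin d)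
  | 0 => x₀
  | k + 1 =>
    push (∑ i, θ ((k : ℝ) / n) i * state θ σ n x₀ e k i + σ (((k : ℝ) + 1) / n) * e (k + 1))
      (state θ σ n x₀ e k)

/-- The scalar observation `X_{k+1,n}` (for `d ≥ 1`, the first coordinate of `𝐗_{k+1,n}`). -/
def obs {d : ℕ} (θ : ℝ → EuclideanSpace ℝ (Fin d)) (σ : ℝ → ℝ) (n : ℕ)
    (x₀ : EuclideanSpace ℝ (Fin d)) (e : ℕ → ℝ) (k : ℕ) : ℝ :=
  ∑ i, θ ((k : ℝ) / n) i * state θ σ n x₀ e k i + σ (((k : ℝ) + 1) / n) * e (k + 1)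

/-- The whole sample `(𝐗_{0,n}, X_{1,n}, …, X_{n,n})`; the entry of index `k` in `Fin n` is
`X_{k+1,n}`. -/
def sample {d : ℕ} (θ : ℝ → EuclideanSpace ℝ (Fin d)) (σ : ℝ → ℝ) (n : ℕ)
    (x₀ : EuclideanSpace ℝ (Fin d)) (e : ℕ → ℝ) : EuclideanSpace ℝ (Fin d) × (Fin n → ℝ) :=
  (x₀, fun k => obs θ σ n x₀ e k)

/-- The `β`-Lipschitz ball of radius `L`: with `β = m + α`, `m ∈ ℕ`, `α ∈ (0, 1]` (so that
`m = ⌈β⌉ - 1`), the derivative of order `m` on `[0, 1]` is `α`-Hölder with constant `L`, and the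
function is bounded by `L`. Only the values on `[0, 1]` matter. -/
def LipBall (d : ℕ) (β L : ℝ) : Set (ℝ → EuclideanSpace ℝ (Fin d)) :=
  {f | ContDiffOn ℝ ((⌈β⌉₊ - 1 : ℕ) : WithTop ℕ∞) f (Set.Icc 0 1) ∧
    (∀ s ∈ Set.Icc (0 : ℝ) 1, ∀ t ∈ Set.Icc (0 : ℝ) 1,
      ‖iteratedDerivWithin (⌈β⌉₊ - 1) f (Set.Icc 0 1) t
        - iteratedDerivWithin (⌈β⌉₊ - 1) f (Set.Icc 0 1) s‖
          ≤ L * |t - s| ^ (β - ((⌈β⌉₊ - 1 : ℕ) : ℝ))) ∧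
    ∀ t ∈ Set.Icc (0 : ℝ) 1, ‖f t‖ ≤ L}

/-- The stability class: for every `t ∈ [0, 1]` the autoregressive polynomial
`z ↦ 1 - ∑ⱼ θⱼ(t) zʲ` has no complex zero with `|z| < 1 / ρ`. -/
def StableClass (d : ℕ) (ρ : ℝ) : Set (ℝ → EuclideanSpace ℝ (Fin d)) :=
  {θ | ∀ t ∈ Set.Icc (0 : ℝ) 1, ∀ z : ℂ, ‖z‖ < ρ⁻¹ →
    1 - ∑ j : Fin d, (θ t j : ℂ) * z ^ ((j : ℕ) + 1) ≠ 0}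

/-- The parameter class `𝒞(β, L, ρ, σ₋, σ₊)`. -/
def ParamClass (d : ℕ) (β L ρ σm σp : ℝ) :
    Set ((ℝ → EuclideanSpace ℝ (Fin d)) × (ℝ → ℝ)) :=
  {p | p.1 ∈ LipBall d β L ∩ StableClass d ρ ∧ ∀ t ∈ Set.Icc (0 : ℝ) 1, p.2 t ∈ Set.Icc σm σp}

/-- The moment and independence assumption on the innovations `ε n k`, `1 ≤ k ≤ n`, and on the
initial conditions `X₀ n`, `n ≥ 1`, with moment order `q`. -/
structure AssumptionA1 {Ω : Type*} [MeasurableSpace Ω] (P : Measure Ω) {d : ℕ} (q : ℝ≥0∞)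
    (ε : ℕ → ℕ → Ω → ℝ) (X₀ : ℕ → Ω → EuclideanSpace ℝ (Fin d)) : Prop where
  measurable_innov : ∀ n k, 1 ≤ k → k ≤ n → Measurable (ε n k)
  measurable_init : ∀ n, 1 ≤ n → Measurable (X₀ n)
  indep_innov : ∀ n, 1 ≤ n → iIndepFun (fun k : Finset.Icc 1 n => ε n k) P
  indep_init : ∀ n, 1 ≤ n → IndepFun (X₀ n) (fun ω (k : Finset.Icc 1 n) => ε n k ω) P
  mean_zero : ∀ n k, 1 ≤ k → k ≤ n → ∫ ω, ε n k ω ∂P = 0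
  unit_variance : ∀ n k, 1 ≤ k → k ≤ n → variance (ε n k) P = 1
  init_bounded : ⨆ (n : ℕ) (_ : 1 ≤ n), eLpNorm (X₀ n) q P < ∞
  innov_bounded : ⨆ (n : ℕ) (k : ℕ) (_ : 1 ≤ k) (_ : k ≤ n), eLpNorm (ε n k) q P < ∞

/-- The finite Fisher information assumption: each `ε n k`, `1 ≤ k ≤ n`, has a density `p n k` with
respect to Lebesgue measure that is absolutely continuous on every compact interval, the score
`(p n k)' / p n k` at `ε n k` has zero mean, and its second moments are uniformly bounded. -/
def AssumptionA2 {Ω : Type*} [MeasurableSpace Ω] (P : Measure Ω) (ε : ℕ → ℕ → Ω → ℝ) : Prop :=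
  ∃ p : ℕ → ℕ → ℝ → ℝ,
    (∀ n k, 1 ≤ k → k ≤ n →
      (∀ x, 0 ≤ p n k x) ∧
      P.map (ε n k) = volume.withDensity (fun x => ENNReal.ofReal (p n k x)) ∧
      (∀ a b, AbsolutelyContinuousOnInterval (p n k) a b) ∧
      ∫ ω, deriv (p n k) (ε n k ω) / p n k (ε n k ω) ∂P = 0) ∧
    ⨆ (n : ℕ) (k : ℕ) (_ : 1 ≤ k) (_ : k ≤ n),
      ∫⁻ ω, ENNReal.ofReal ((deriv (p n k) (ε n k ω) / p n k (ε n k ω)) ^ 2) ∂P < ∞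

/-- The mean square error matrix `E[err errᵀ]` of a random error vector. -/
def msem {Ω : Type*} [MeasurableSpace Ω] (P : Measure Ω) {d : ℕ}
    (err : Ω → EuclideanSpace ℝ (Fin d)) : Matrix (Fin d) (Fin d) ℝ :=
  fun i j => ∫ ω, err ω i * err ω j ∂P

/-- The quadratic form `uᵀ E[err errᵀ] u = E[(uᵀ err)²]` of the mean square error matrix, with
value `∞` when `uᵀ err` is not square integrable. -/
def msemForm {Ω : Type*} [MeasurableSpace Ω] (P : Measure Ω) {d : ℕ}
    (err : Ω → EuclideanSpace ℝ (Fin d)) (u : EuclideanSpace ℝ (Fin d)) : ℝ≥0∞ :=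
  ∫⁻ ω, ENNReal.ofReal ((∑ i, u i * err ω i) ^ 2) ∂P

/-- For a square integrable error vector, the extended quadratic form is that of the matrix. -/
theorem msemForm_eq {Ω : Type*} [MeasurableSpace Ω] (P : Measure Ω) {d : ℕ}
    (err : Ω → EuclideanSpace ℝ (Fin d)) (u : EuclideanSpace ℝ (Fin d))
    (h : ∀ i, MemLp (fun ω => err ω i) 2 P) :
    msemForm P err u = ENNReal.ofReal (∑ i, ∑ j, u i * msem P err i j * u j) := by
  have hint : ∀ i j, Integrable (fun ω => err ω i * err ω j) P := fun i j =>
    (h i).integrable_mul (h j)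
  have hexp : ∀ ω, (∑ i, u i * err ω i) ^ 2 = ∑ i, ∑ j, u i * (err ω i * err ω j) * u j := by
    intro ω
    rw [sq, Finset.sum_mul_sum]
    exact Finset.sum_congr rfl fun i _ => Finset.sum_congr rfl fun j _ => by ring
  have hi : ∀ i j, Integrable (fun ω => u i * (err ω i * err ω j) * u j) P := fun i j =>
    ((hint i j).const_mul _).mul_const _
  have hs : Integrable (fun ω => (∑ i, u i * err ω i) ^ 2) P := by
    simp only [hexp]
    exact integrable_finsetSum _ fun i _ => integrable_finsetSum _ fun j _ => hi i j
  rw [msemForm, ← ofReal_integral_eq_lintegral_ofReal hs (Filter.Eventually.of_forall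
    fun ω => sq_nonneg _)]
  congr 1
  simp only [hexp]
  rw [integral_finsetSum _ fun i _ => integrable_finsetSum _ fun j _ => hi i j]
  refine Finset.sum_congr rfl fun i _ => ?_
  rw [integral_finsetSum _ fun j _ => hi i j]
  refine Finset.sum_congr rfl fun j _ => ?_
  rw [integral_mul_const, integral_const_mul]
  rfl

end TVAR

end

/-!
The lower bound is a two-point argument. Fix the direction `u`, take the noise level constant equal
to `σ₋` and compare the coefficient `0` with `θ(s) = τ b ^ β w((s - t) / b) u`, where `w` is a smooth
bump and `b = n ^ (-1 / (1 + 2 β))`. Both belong to the parameter class once `τ` is small, and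
`uᵀ θ(t) = τ b ^ β`, whose square is of the announced order. It remains to see that the laws of the
samples do not separate.

Their separation is measured by the Hellinger affinity. If `p` is a density of Fisher information `J`,
then `√p` is `L²`-Lipschitz in location, and the affinity of `p` and its translate by `h` is at least
`1 - J h² / 8` (`one_le_lintegral_sqrt_shiftRatio`). Under the coefficient `0` the observations are
`X_k = σ₋ y_k` with independent `y_k`; under `θ` the variable `y_k` is translated by the predictable
quantity `θᵀ 𝐗_{k-1} / σ₋`. If `L` is the likelihood ratio of the past, the affinity of the path
decreases at each step by at most the mean of `√L J h² / 8 ≤ (1 + L) J h² / 16`, so that only second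
moments of the translations under *both* laws are needed (`one_le_lintegral_sqrt_partialRatio`). These
are bounded because a small `θ` makes the recursion a contraction (`lintegral_state_sq_le`). The total
loss is at most a constant times `∑ₖ ‖θ(k / n)‖² ≤ 3 τ² (n b) b ^ (2 β) = 3 τ²`, hence small.

All computations are done in the product space of the innovations, for a fixed initial condition. The
passage between the two laws (`lintegral_partialRatio_mul_le`) removes the translations one coordinate
at a time, so that the joint density of the sample never appears. Densities may vanish: the likelihood
ratio is then `0`, and the change of measure is an inequality, in the direction the bound requires.
-/

/-! ### Densities of finite Fisher information -/

theorem AbsolutelyContinuousOnInterval.sqrt_add {p : ℝ → ℝ} (hp0 : ∀ x, 0 ≤ p x) {a b δ : ℝ}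
    (hp : AbsolutelyContinuousOnInterval p a b) (hδ : 0 < δ) :
    AbsolutelyContinuousOnInterval (fun x => √(p x + δ)) a b := by
  have hK := hp.const_mul (√δ)⁻¹
  have key : ∀ x y, dist (√(p x + δ)) (√(p y + δ)) ≤ dist ((√δ)⁻¹ * p x) ((√δ)⁻¹ * p y) := by
    intro x y
    have hs : 0 < √δ := Real.sqrt_pos.2 hδ
    have hx : √δ ≤ √(p x + δ) := Real.sqrt_le_sqrt (by linarith [hp0 x])
    have hy : 0 ≤ √(p y + δ) := Real.sqrt_nonneg _
    have h1 : p x - p y = (√(p x + δ) - √(p y + δ)) * (√(p x + δ) + √(p y + δ)) := by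
      have e1 := Real.sq_sqrt (by linarith [hp0 x] : 0 ≤ p x + δ)
      have e2 := Real.sq_sqrt (by linarith [hp0 y] : 0 ≤ p y + δ)
      linarith
    rw [Real.dist_eq, Real.dist_eq, ← mul_sub, h1, abs_mul, abs_mul,
      abs_of_pos (inv_pos.2 hs), abs_of_nonneg (by linarith : 0 ≤ √(p x + δ) + √(p y + δ)),
      inv_mul_eq_div, le_div_iff₀ hs]
    exact mul_le_mul_of_nonneg_left (by linarith) (abs_nonneg _)
  exact squeeze_zero (fun E => Finset.sum_nonneg fun _ _ => dist_nonneg)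
    (fun E => Finset.sum_le_sum fun _ _ => key _ _) hK

namespace TVAR

/-- The density of Fisher information `(p'/p)² p`, with value `0` where `p` vanishes. -/
noncomputable def fisherDensity (p : ℝ → ℝ) (x : ℝ) : ℝ≥0∞ :=
  ENNReal.ofReal (p x) * ENNReal.ofReal ((deriv p x / p x) ^ 2)

theorem continuous_of_absolutelyContinuousOnInterval {p : ℝ → ℝ}
    (hac : ∀ a b, AbsolutelyContinuousOnInterval p a b) : Continuous p := by
  refine continuous_iff_continuousAt.2 fun x => ?_
  refine (hac (x - 1) (x + 1)).continuousOn.continuousAt ?_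
  rw [Set.uIcc_of_le (by linarith)]
  exact Icc_mem_nhds (by linarith) (by linarith)

theorem measurable_fisherDensity {p : ℝ → ℝ} (hp : Measurable p) :
    Measurable (fisherDensity p) := by
  unfold fisherDensity
  exact hp.ennreal_ofReal.mul (((measurable_deriv p).div hp).pow_const 2).ennreal_ofReal

theorem deriv_eq_zero_of_nonneg {p : ℝ → ℝ} (hp0 : ∀ x, 0 ≤ p x) {x : ℝ} (hx : p x = 0) :
    deriv p x = 0 :=
  IsLocalMin.deriv_eq_zero (Filter.Eventually.of_forall fun y => hx ▸ hp0 y)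

/-- An increment of `√(p + δ)` is controlled, uniformly in `δ`, by the integral of
`|p'| / (2 √p)`: where `p` vanishes it is minimal, so `p'` vanishes as well. -/
theorem enorm_sqrt_add_sub_le {p : ℝ → ℝ} (hp0 : ∀ x, 0 ≤ p x) {a b : ℝ} (hab : a ≤ b)
    (hac : AbsolutelyContinuousOnInterval p a b) {δ : ℝ} (hδ : 0 < δ) :
    ‖√(p b + δ) - √(p a + δ)‖ₑ ≤
      ∫⁻ x in Set.Ioc a b, ENNReal.ofReal (|deriv p x| / (2 * √(p x))) := by
  have hs := hac.sqrt_add hp0 hδ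
  rw [← hs.integral_deriv_eq_sub, intervalIntegral.integral_of_le hab]
  refine (enorm_integral_le_lintegral_enorm _).trans ?_
  refine lintegral_mono_ae ((ae_restrict_iff' measurableSet_Ioc).2 ?_)
  filter_upwards [hac.ae_differentiableAt] with x hx hxI
  have hd := (hx (by rw [Set.uIcc_of_le hab]; exact Set.Ioc_subset_Icc_self hxI)).hasDerivAt
  have hpos : p x + δ ≠ 0 := (by linarith [hp0 x] : 0 < p x + δ).ne'
  rw [((hd.add_const δ).sqrt hpos).deriv, Real.enorm_eq_ofReal_abs]
  refine ENNReal.ofReal_le_ofReal ?_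
  rcases (hp0 x).eq_or_lt with h | h
  · simp [deriv_eq_zero_of_nonneg hp0 h.symm]
  · rw [abs_div, abs_of_nonneg (by positivity : 0 ≤ 2 * √(p x + δ))]
    have : 0 < √(p x) := Real.sqrt_pos.2 h
    have h2 : √(p x) ≤ √(p x + δ) := Real.sqrt_le_sqrt (by linarith)
    gcongr

theorem ofReal_sqrt_sub_sq_le {p : ℝ → ℝ} (hp0 : ∀ x, 0 ≤ p x) {a b : ℝ} (hab : a ≤ b)
    (hac : ∀ a b, AbsolutelyContinuousOnInterval p a b) :
    ENNReal.ofReal ((√(p b) - √(p a)) ^ 2) ≤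
      ENNReal.ofReal ((b - a) / 4) * ∫⁻ x in Set.Ioc a b, fisherDensity p x := by
  have hpc := continuous_of_absolutelyContinuousOnInterval hac
  have hpm := hpc.measurable
  set g : ℝ → ℝ≥0∞ := fun x => ENNReal.ofReal (|deriv p x| / (2 * √(p x))) with hg
  have hgm : Measurable g := by
    have := measurable_deriv p
    exact ((this.abs).div (hpm.sqrt.const_mul 2)).ennreal_ofReal
  have h1 : ‖√(p b) - √(p a)‖ₑ ≤ ∫⁻ x in Set.Ioc a b, g x := by
    have ht : Filter.Tendsto (fun δ : ℝ => ‖√(p b + δ) - √(p a + δ)‖ₑ) (nhdsWithin 0 (Set.Ioi 0))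
        (nhds ‖√(p b) - √(p a)‖ₑ) := by
      have : Continuous (fun δ : ℝ => ‖√(p b + δ) - √(p a + δ)‖ₑ) := by fun_prop
      have := this.tendsto 0
      simp only [add_zero] at this
      exact this.mono_left nhdsWithin_le_nhds
    refine le_of_tendsto ht ?_
    filter_upwards [self_mem_nhdsWithin] with δ hδ
    exact enorm_sqrt_add_sub_le hp0 hab (hac a b) hδ
  have h2 : (∫⁻ x in Set.Ioc a b, g x) ≤
      (∫⁻ x in Set.Ioc a b, g x ^ (2 : ℝ)) ^ (1 / 2 : ℝ) * (ENNReal.ofReal (b - a)) ^ (1 / 2 : ℝ) := by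
    have := ENNReal.lintegral_mul_le_Lp_mul_Lq (volume.restrict (Set.Ioc a b))
      Real.HolderConjugate.two_two hgm.aemeasurable (g := fun _ => 1) aemeasurable_const
    simpa using this
  have h3 : ∀ x, g x ^ (2 : ℝ) = ENNReal.ofReal (1 / 4) * fisherDensity p x := by
    intro x
    rw [hg, fisherDensity, ← ENNReal.ofReal_mul (hp0 x), ← ENNReal.ofReal_mul (by norm_num),
      ENNReal.rpow_two, ← ENNReal.ofReal_pow (by positivity)]
    congr 1
    rcases (hp0 x).eq_or_lt with h | h
    · simp [← h]
    · rw [div_pow, mul_pow, Real.sq_sqrt h.le, sq_abs]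
      field_simp
      norm_num
  rw [← sq_abs, ENNReal.ofReal_pow (abs_nonneg _), ← Real.enorm_eq_ofReal_abs]
  calc ‖√(p b) - √(p a)‖ₑ ^ 2 ≤ ((∫⁻ x in Set.Ioc a b, g x ^ (2 : ℝ)) ^ (1 / 2 : ℝ) *
        (ENNReal.ofReal (b - a)) ^ (1 / 2 : ℝ)) ^ 2 := by gcongr; exact h1.trans h2
    _ = (∫⁻ x in Set.Ioc a b, g x ^ (2 : ℝ)) * ENNReal.ofReal (b - a) := by
        rw [mul_pow, ← ENNReal.rpow_natCast, ← ENNReal.rpow_natCast, ← ENNReal.rpow_mul,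
          ← ENNReal.rpow_mul]
        norm_num
    _ = _ := by
        simp_rw [h3]
        rw [lintegral_const_mul _ (measurable_fisherDensity hpm), mul_right_comm,
          ← ENNReal.ofReal_mul (by norm_num)]
        congr 2
        ring

/-- The root of a density with finite Fisher information is `L²`-Lipschitz in location. -/
theorem lintegral_sqrt_sub_sq_le {p : ℝ → ℝ} (hp0 : ∀ x, 0 ≤ p x)
    (hac : ∀ a b, AbsolutelyContinuousOnInterval p a b) (h : ℝ) :
    ∫⁻ y, ENNReal.ofReal ((√(p (y - h)) - √(p y)) ^ 2) ≤
      ENNReal.ofReal (h ^ 2 / 4) * ∫⁻ x, fisherDensity p x := by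
  have hpm := (continuous_of_absolutelyContinuousOnInterval hac).measurable
  have hqm := measurable_fisherDensity hpm
  have main : ∀ h : ℝ, 0 ≤ h → ∫⁻ y, ENNReal.ofReal ((√(p (y + h)) - √(p y)) ^ 2) ≤
      ENNReal.ofReal (h ^ 2 / 4) * ∫⁻ x, fisherDensity p x := by
    intro h hh
    have hin : ∀ y, (∫⁻ x in Set.Ioc y (y + h), fisherDensity p x) =
        ∫⁻ s in Set.Ioc 0 h, fisherDensity p (y + s) := by
      intro y
      rw [← lintegral_indicator measurableSet_Ioc, ← lintegral_indicator measurableSet_Ioc,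
        ← lintegral_add_left_eq_self _ y]
      congr 1
      ext s
      by_cases hs : s ∈ Set.Ioc 0 h
      · rw [Set.indicator_of_mem hs, Set.indicator_of_mem]
        exact ⟨by linarith [hs.1], by linarith [hs.2]⟩
      · rw [Set.indicator_of_notMem hs, Set.indicator_of_notMem]
        exact fun hc => hs ⟨by linarith [hc.1], by linarith [hc.2]⟩
    calc ∫⁻ y, ENNReal.ofReal ((√(p (y + h)) - √(p y)) ^ 2)
        ≤ ∫⁻ y, ENNReal.ofReal (h / 4) * ∫⁻ s in Set.Ioc 0 h, fisherDensity p (y + s) := by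
          refine lintegral_mono fun y => ?_
          have := ofReal_sqrt_sub_sq_le hp0 (by linarith : y ≤ y + h) hac
          rw [hin] at this
          simpa using this
      _ = ENNReal.ofReal (h / 4) * ∫⁻ s in Set.Ioc 0 h, ∫⁻ y, fisherDensity p (y + s) := by
          have hm : Measurable (fun z : ℝ × ℝ => fisherDensity p (z.1 + z.2)) :=
            hqm.comp (measurable_fst.add measurable_snd)
          rw [lintegral_const_mul _ hm.lintegral_prod_right', lintegral_lintegral_swap
            hm.aemeasurable]
      _ = _ := by
          simp_rw [lintegral_add_right_eq_self (fisherDensity p)]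
          rw [lintegral_const, Measure.restrict_apply_univ, Real.volume_Ioc, sub_zero, mul_comm _ (ENNReal.ofReal h),
            ← mul_assoc, ← ENNReal.ofReal_mul (by positivity)]
          congr 2
          ring
  rcases le_total 0 h with hh | hh
  · rw [← lintegral_add_right_eq_self _ h]
    simp only [add_sub_cancel_right]
    refine le_trans (le_of_eq ?_) (main h hh)
    congr 1; ext y; congr 1; ring
  · have := main (-h) (by linarith)
    simpa [sub_eq_add_neg] using this

/-- The likelihood ratio at `y` of the density `p` translated by `h` with respect to `p`, with value
`0` where `p` vanishes. -/
noncomputable def shiftRatio (p : ℝ → ℝ) (h y : ℝ) : ℝ := p (y - h) / p y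

theorem shiftRatio_nonneg {p : ℝ → ℝ} (hp0 : ∀ x, 0 ≤ p x) (h y : ℝ) : 0 ≤ shiftRatio p h y :=
  div_nonneg (hp0 _) (hp0 _)

theorem measurable_shiftRatio {p : ℝ → ℝ} (hp : Measurable p) :
    Measurable (fun z : ℝ × ℝ => shiftRatio p z.1 z.2) :=
  (hp.comp (measurable_snd.sub measurable_fst)).div (hp.comp measurable_snd)

/-- Weighting by the likelihood ratio amounts to a translation by `h`; only an inequality holds, as
the translated law may charge the zeros of `p`. -/
theorem lintegral_shiftRatio_mul_le {p : ℝ → ℝ} (hp0 : ∀ x, 0 ≤ p x) (hp : Measurable p) (h : ℝ)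
    {φ : ℝ → ℝ≥0∞} (hφ : Measurable φ) :
    ∫⁻ y, ENNReal.ofReal (shiftRatio p h y) * φ (y - h)
        ∂(volume.withDensity fun x => ENNReal.ofReal (p x)) ≤
      ∫⁻ y, φ y ∂(volume.withDensity fun x => ENNReal.ofReal (p x)) := by
  have hr : Measurable (shiftRatio p h) :=
    (measurable_shiftRatio hp).comp (measurable_const.prodMk measurable_id)
  have hm : Measurable fun y => ENNReal.ofReal (shiftRatio p h y) * φ (y - h) :=
    hr.ennreal_ofReal.mul (hφ.comp (measurable_id.sub_const h))
  rw [lintegral_withDensity_eq_lintegral_mul _ hp.ennreal_ofReal hm,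
    lintegral_withDensity_eq_lintegral_mul _ hp.ennreal_ofReal hφ,
    ← lintegral_sub_right_eq_self (fun y => ((fun x => ENNReal.ofReal (p x)) * φ) y) h]
  refine lintegral_mono fun y => ?_
  simp only [Pi.mul_apply]
  rw [← mul_assoc, ← ENNReal.ofReal_mul (hp0 y)]
  gcongr
  rw [shiftRatio]
  rcases (hp0 y).eq_or_lt with h0 | h0
  · simp [← h0, hp0]
  · rw [mul_div_cancel₀ _ h0.ne']

/-- The Hellinger affinity of a density of finite Fisher information and its translate by `h` is at
least `1 - h² J / 8`. -/
theorem one_le_lintegral_sqrt_shiftRatio {p : ℝ → ℝ} (hp0 : ∀ x, 0 ≤ p x)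
    (hac : ∀ a b, AbsolutelyContinuousOnInterval p a b)
    (hp1 : ∫⁻ x, ENNReal.ofReal (p x) = 1) (h : ℝ) :
    1 ≤ (∫⁻ y, ENNReal.ofReal √(shiftRatio p h y)
        ∂(volume.withDensity fun x => ENNReal.ofReal (p x))) +
      ENNReal.ofReal (h ^ 2 / 8) * ∫⁻ x, fisherDensity p x := by
  have hp := (continuous_of_absolutelyContinuousOnInterval hac).measurable
  have hr : Measurable (shiftRatio p h) :=
    (measurable_shiftRatio hp).comp (measurable_const.prodMk measurable_id)
  rw [lintegral_withDensity_eq_lintegral_mul _ hp.ennreal_ofReal hr.sqrt.ennreal_ofReal]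
  set A := ∫⁻ y, ((fun x => ENNReal.ofReal (p x)) * fun y => ENNReal.ofReal √(shiftRatio p h y)) y
  have hsub : Measurable fun y => p (y - h) := hp.comp (measurable_id.sub_const h)
  have hpt : ∀ y, ENNReal.ofReal (p (y - h)) + ENNReal.ofReal (p y) = 2 *
      (ENNReal.ofReal (p y) * ENNReal.ofReal √(shiftRatio p h y)) +
      ENNReal.ofReal ((√(p (y - h)) - √(p y)) ^ 2) := by
    intro y
    rw [← ENNReal.ofReal_mul (hp0 y), ← ENNReal.ofReal_add (hp0 _) (hp0 _),
      show (2 : ℝ≥0∞) = ENNReal.ofReal 2 by simp, ← ENNReal.ofReal_mul (by norm_num),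
      ← ENNReal.ofReal_add (mul_nonneg two_pos.le (mul_nonneg (hp0 y) (Real.sqrt_nonneg _)))
        (sq_nonneg _)]
    congr 1
    have e1 : p y * √(shiftRatio p h y) = √(p (y - h)) * √(p y) := by
      rw [shiftRatio, Real.sqrt_div (hp0 _)]
      rcases (hp0 y).eq_or_lt with h0 | h0
      · simp [← h0]
      · have : √(p y) ≠ 0 := (Real.sqrt_pos.2 h0).ne'
        have e2 := Real.sq_sqrt h0.le
        field_simp
        linear_combination (-√(p (y - h))) * e2
    rw [e1, sub_sq, Real.sq_sqrt (hp0 _), Real.sq_sqrt (hp0 _)]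
    ring
  have h2 : (2 : ℝ≥0∞) ≤ 2 * A + ENNReal.ofReal (h ^ 2 / 4) * ∫⁻ x, fisherDensity p x := by
    calc (2 : ℝ≥0∞) = ∫⁻ y, (ENNReal.ofReal (p (y - h)) + ENNReal.ofReal (p y)) := by
          rw [lintegral_add_right _ hp.ennreal_ofReal,
            lintegral_sub_right_eq_self (fun y => ENNReal.ofReal (p y)) h, hp1]
          norm_num
      _ = 2 * A + ∫⁻ y, ENNReal.ofReal ((√(p (y - h)) - √(p y)) ^ 2) := by
          have hm : Measurable fun y => ENNReal.ofReal ((√(p (y - h)) - √(p y)) ^ 2) :=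
            ((hsub.sqrt.sub hp.sqrt).pow_const 2).ennreal_ofReal
          have hm' : Measurable fun y => ENNReal.ofReal (p y) * ENNReal.ofReal √(shiftRatio p h y) :=
            hp.ennreal_ofReal.mul hr.sqrt.ennreal_ofReal
          simp_rw [hpt]
          rw [lintegral_add_right _ hm, lintegral_const_mul _ hm']
          rfl
      _ ≤ _ := by gcongr; exact lintegral_sqrt_sub_sq_le hp0 hac h
  have h3 : ENNReal.ofReal (h ^ 2 / 4) = 2 * ENNReal.ofReal (h ^ 2 / 8) := by
    rw [show (2 : ℝ≥0∞) = ENNReal.ofReal 2 by simp, ← ENNReal.ofReal_mul (by norm_num)]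
    congr 1; ring
  rw [h3, mul_assoc, ← mul_add] at h2
  refine (ENNReal.mul_le_mul_iff_right (a := 2) (by norm_num) (by norm_num)).1 ?_
  simpa using h2

end TVAR

/-! ### Products of densities with predictable shifts -/

namespace TVAR

/-- Resampling one coordinate does not change a product of probability measures. -/
theorem lintegral_pi_update {ι : Type*} [Fintype ι] [DecidableEq ι] {X : ι → Type*}
    [∀ i, MeasurableSpace (X i)] (μ : ∀ i, Measure (X i))
    [∀ i, IsProbabilityMeasure (μ i)] (i : ι) {F : (∀ i, X i) → ℝ≥0∞} (hF : Measurable F) :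
    ∫⁻ y, ∫⁻ e, F (Function.update y i e) ∂μ i ∂Measure.pi μ = ∫⁻ y, F y ∂Measure.pi μ := by
  have hG : Measurable (∫⋯∫⁻_{i}, F ∂μ) := hF.lmarginal μ
  have h := lintegral_eq_of_lmarginal_eq {i} hG hF (μ := μ) (by
    rw [lmarginal_singleton (∫⋯∫⁻_{i}, F ∂μ)]
    ext x
    simp [lmarginal_update_of_mem])
  rwa [lmarginal_singleton] at h

variable {n : ℕ}

/-- Shifts `h j` of the coordinates of a point `y` are predictable when `h j y` depends on the
coordinates of `y` of index less than `j` only. -/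
def IsPredictable (h : Fin n → (Fin n → ℝ) → ℝ) : Prop :=
  ∀ ⦃j i⦄, j ≤ i → ∀ y e, h j (Function.update y i e) = h j y

/-- The likelihood ratio of the first `k` observations, the `j`-th one being translated by
`h j`. -/
noncomputable def partialRatio (p : Fin n → ℝ → ℝ) (h : Fin n → (Fin n → ℝ) → ℝ) (k : ℕ)
    (y : Fin n → ℝ) : ℝ :=
  ∏ j ∈ Finset.univ.filter fun j : Fin n => (j : ℕ) < k, shiftRatio (p j) (h j y) (y j)

/-- The first `k` innovations reconstructed from observations `y` by removing the shifts, followed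
by the remaining coordinates of `y`. -/
noncomputable def unshift (h : Fin n → (Fin n → ℝ) → ℝ) (k : ℕ) (y : Fin n → ℝ) : Fin n → ℝ :=
  fun j => if (j : ℕ) < k then y j - h j y else y j

section

variable {p : Fin n → ℝ → ℝ} {h : Fin n → (Fin n → ℝ) → ℝ}

theorem filter_lt_succ (k : Fin n) :
    (Finset.univ.filter fun j : Fin n => (j : ℕ) < (k : ℕ) + 1) =
      insert k (Finset.univ.filter fun j : Fin n => (j : ℕ) < (k : ℕ)) := by
  ext j
  simp only [Finset.mem_filter, Finset.mem_univ, true_and, Finset.mem_insert, Fin.ext_iff]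
  omega

@[simp]
theorem partialRatio_zero (y : Fin n → ℝ) : partialRatio p h 0 y = 1 := by
  simp [partialRatio]

theorem partialRatio_succ (k : Fin n) (y : Fin n → ℝ) :
    partialRatio p h (k + 1) y = partialRatio p h k y * shiftRatio (p k) (h k y) (y k) := by
  rw [partialRatio, filter_lt_succ, Finset.prod_insert (by simp), mul_comm, partialRatio]

theorem partialRatio_nonneg (hp0 : ∀ j x, 0 ≤ p j x) (k : ℕ) (y : Fin n → ℝ) :
    0 ≤ partialRatio p h k y :=
  Finset.prod_nonneg fun j _ => shiftRatio_nonneg (hp0 j) _ _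

theorem partialRatio_update (hh : IsPredictable h) (k : Fin n) (y : Fin n → ℝ) (e : ℝ) :
    partialRatio p h k (Function.update y k e) = partialRatio p h k y := by
  refine Finset.prod_congr rfl fun j hj => ?_
  have hj : j < k := by simpa using hj
  rw [hh hj.le, Function.update_of_ne hj.ne]

theorem measurable_partialRatio (hp : ∀ j, Measurable (p j)) (hm : ∀ j, Measurable (h j)) (k : ℕ) :
    Measurable (partialRatio p h k) :=
  Finset.measurable_fun_prod _ fun j _ =>
    (measurable_shiftRatio (hp j)).comp ((hm j).prodMk (measurable_pi_apply j))

@[simp]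
theorem unshift_zero (y : Fin n → ℝ) : unshift h 0 y = y := by
  ext; simp [unshift]

theorem unshift_update (hh : IsPredictable h) (k : Fin n) (y : Fin n → ℝ) (e : ℝ) :
    unshift h k (Function.update y k e) = Function.update (unshift h k y) k e := by
  ext j
  rcases lt_trichotomy j k with hj | rfl | hj
  · simp [unshift, hj.ne, hh hj.le, hj]
  · simp [unshift]
  · simp [unshift, hj.ne', hj.not_gt]

theorem unshift_succ_update (hh : IsPredictable h) (k : Fin n) (y : Fin n → ℝ) (e : ℝ) :
    unshift h (k + 1) (Function.update y k e) =
      Function.update (unshift h k y) k (e - h k y) := by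
  ext j
  rcases lt_trichotomy j k with hj | rfl | hj
  · have : (j : ℕ) < k + 1 := by omega
    simp [unshift, hj.ne, hh hj.le, hj, this]
  · simp [unshift, hh le_rfl]
  · have : ¬ (j : ℕ) < k + 1 := by omega
    simp [unshift, hj.ne', hj.not_gt, this]

theorem measurable_unshift (hm : ∀ j, Measurable (h j)) (k : ℕ) : Measurable (unshift h k) := by
  refine measurable_pi_lambda _ fun j => ?_
  unfold unshift
  split_ifs
  · exact (measurable_pi_apply j).sub (hm j)
  · exact measurable_pi_apply j

variable {μ : Fin n → Measure ℝ} [∀ j, IsProbabilityMeasure (μ j)]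

/-- Change of measure: under the likelihood ratio, the reconstructed innovations are dominated by
the innovations. The coordinates are shifted back one at a time, the last one first, by
resampling. -/
theorem lintegral_partialRatio_mul_le (hp0 : ∀ j x, 0 ≤ p j x) (hp : ∀ j, Measurable (p j))
    (hμ : ∀ j, μ j = volume.withDensity fun x => ENNReal.ofReal (p j x))
    (hh : IsPredictable h) (hm : ∀ j, Measurable (h j)) {k : ℕ} (hk : k ≤ n)
    {ψ : (Fin n → ℝ) → ℝ≥0∞} (hψ : Measurable ψ) :
    ∫⁻ y, ENNReal.ofReal (partialRatio p h k y) * ψ (unshift h k y) ∂Measure.pi μ ≤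
      ∫⁻ y, ψ y ∂Measure.pi μ := by
  have hF : ∀ k, Measurable fun y => ENNReal.ofReal (partialRatio p h k y) * ψ (unshift h k y) :=
    fun k => (measurable_partialRatio hp hm k).ennreal_ofReal.mul
      (hψ.comp (measurable_unshift hm k))
  induction k with
  | zero => simp
  | succ k ih =>
    refine le_trans ?_ (ih (by omega))
    obtain ⟨k, rfl⟩ : ∃ i : Fin n, (i : ℕ) = k := ⟨⟨k, hk⟩, rfl⟩
    rw [← lintegral_pi_update μ k (hF k), ← lintegral_pi_update μ k (hF (k + 1))]
    refine lintegral_mono fun y => ?_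
    have hy : Measurable fun e => ψ (Function.update (unshift h k y) k e) :=
      hψ.comp (measurable_update _)
    have hr : Measurable fun e => ENNReal.ofReal (shiftRatio (p k) (h k y) e) *
        ψ (Function.update (unshift h k y) k (e - h k y)) :=
      ((measurable_shiftRatio (hp k)).comp (measurable_const.prodMk measurable_id)).ennreal_ofReal.mul
        (hy.comp (measurable_id.sub_const _))
    simp_rw [partialRatio_succ, unshift_succ_update hh, unshift_update hh, partialRatio_update hh,
      hh le_rfl, Function.update_self, ENNReal.ofReal_mul (partialRatio_nonneg hp0 _ _), mul_assoc]
    rw [lintegral_const_mul _ hy, lintegral_const_mul _ hr]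
    gcongr _ * ?_
    rw [hμ k]
    exact lintegral_shiftRatio_mul_le (hp0 k) (hp k) (h k y) hy

/-- Chain rule for the Hellinger affinity of a sequence of predictable shifts. The increment of the
affinity at each step carries the weight `√L` of the past likelihood ratio `L`, which is at most
`(1 + L) / 2`: this leaves second moments of the shift under both laws. -/
theorem one_le_lintegral_sqrt_partialRatio (hp0 : ∀ j x, 0 ≤ p j x)
    (hac : ∀ j a b, AbsolutelyContinuousOnInterval (p j) a b)
    (hμ : ∀ j, μ j = volume.withDensity fun x => ENNReal.ofReal (p j x))
    (hh : IsPredictable h) (hm : ∀ j, Measurable (h j)) {J : ℝ≥0∞}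
    (hJ : ∀ j, ∫⁻ x, fisherDensity (p j) x ≤ J) {k : ℕ} (hk : k ≤ n) :
    1 ≤ (∫⁻ y, ENNReal.ofReal √(partialRatio p h k y) ∂Measure.pi μ) +
      ∑ j ∈ Finset.univ.filter fun j : Fin n => (j : ℕ) < k, J / 16 * ((∫⁻ y, ENNReal.ofReal (h j y ^ 2) ∂Measure.pi μ) +
        ∫⁻ y, ENNReal.ofReal (partialRatio p h j y) * ENNReal.ofReal (h j y ^ 2)
          ∂Measure.pi μ) := by
  have hp : ∀ j, Measurable (p j) := fun j =>
    (continuous_of_absolutelyContinuousOnInterval (hac j)).measurable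
  have hS : ∀ k, Measurable fun y => ENNReal.ofReal √(partialRatio p h k y) :=
    fun k => (measurable_partialRatio hp hm k).sqrt.ennreal_ofReal
  induction k with
  | zero => simp
  | succ k ih =>
    refine (ih (by omega)).trans ?_
    obtain ⟨k, rfl⟩ : ∃ i : Fin n, (i : ℕ) = k := ⟨⟨k, hk⟩, rfl⟩
    rw [filter_lt_succ, Finset.sum_insert (by simp), ← add_assoc]
    gcongr ?_ + _
    have hh2 : Measurable fun y => ENNReal.ofReal (h k y ^ 2) :=
      ((hm k).pow_const 2).ennreal_ofReal
    have hL : Measurable fun y => ENNReal.ofReal (partialRatio p h k y) :=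
      (measurable_partialRatio hp hm k).ennreal_ofReal
    have h1 : ∫⁻ y, ENNReal.ofReal √(partialRatio p h (k + 1) y) ∂Measure.pi μ =
        ∫⁻ y, ENNReal.ofReal √(partialRatio p h k y) *
          ∫⁻ e, ENNReal.ofReal √(shiftRatio (p k) (h k y) e) ∂μ k ∂Measure.pi μ := by
      rw [← lintegral_pi_update μ k (hS (k + 1))]
      refine lintegral_congr fun y => ?_
      have hr : Measurable fun e => ENNReal.ofReal √(shiftRatio (p k) (h k y) e) :=
        ((measurable_shiftRatio (hp k)).comp
          (measurable_const.prodMk measurable_id)).sqrt.ennreal_ofReal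
      simp_rw [partialRatio_succ, partialRatio_update hh, hh le_rfl, Function.update_self,
        Real.sqrt_mul (partialRatio_nonneg hp0 _ _), ENNReal.ofReal_mul (Real.sqrt_nonneg _)]
      rw [lintegral_const_mul _ hr]
    have h2 : ∀ y, ENNReal.ofReal √(partialRatio p h k y) ≤
        ENNReal.ofReal √(partialRatio p h k y) *
          (∫⁻ e, ENNReal.ofReal √(shiftRatio (p k) (h k y) e) ∂μ k) +
        J / 16 * (ENNReal.ofReal (h k y ^ 2) +
          ENNReal.ofReal (partialRatio p h k y) * ENNReal.ofReal (h k y ^ 2)) := by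
      intro y
      have hp1 : ∫⁻ x, ENNReal.ofReal (p k x) = 1 := by
        have := measure_univ (μ := μ k)
        rwa [hμ k, withDensity_apply _ .univ, Measure.restrict_univ] at this
      have h3 := one_le_lintegral_sqrt_shiftRatio (hp0 k) (hac k) hp1 (h k y)
      rw [← hμ k] at h3
      have hL0 := partialRatio_nonneg (h := h) hp0 k y
      have h4 : √(partialRatio p h k y) ≤ (1 + partialRatio p h k y) / 2 := by
        nlinarith [sq_nonneg (√(partialRatio p h k y) - 1), Real.sq_sqrt hL0]
      have h5 : √(partialRatio p h k y) * (h k y ^ 2 / 8) ≤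
          1 / 16 * (h k y ^ 2 + partialRatio p h k y * h k y ^ 2) := by
        nlinarith [mul_le_mul_of_nonneg_right h4 (sq_nonneg (h k y))]
      calc ENNReal.ofReal √(partialRatio p h k y)
          ≤ ENNReal.ofReal √(partialRatio p h k y) *
            ((∫⁻ e, ENNReal.ofReal √(shiftRatio (p k) (h k y) e) ∂μ k) +
              ENNReal.ofReal (h k y ^ 2 / 8) * J) := by
            refine le_mul_of_one_le_right' (h3.trans ?_)
            gcongr
            exact hJ k
        _ ≤ _ := by
            rw [mul_add, ← mul_assoc, ← ENNReal.ofReal_mul (Real.sqrt_nonneg _)]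
            refine add_le_add le_rfl ?_
            rw [← ENNReal.ofReal_mul hL0, ← ENNReal.ofReal_add (sq_nonneg _)
              (mul_nonneg hL0 (sq_nonneg _)), div_eq_mul_inv J, mul_assoc J, mul_comm _ J,
              show (16 : ℝ≥0∞)⁻¹ = ENNReal.ofReal (1 / 16) by
                rw [one_div, ENNReal.ofReal_inv_of_pos (by norm_num)]; simp,
              ← ENNReal.ofReal_mul (by norm_num)]
            gcongr
    refine (lintegral_mono h2).trans ?_
    have hmr : Measurable fun y => ENNReal.ofReal (h k y ^ 2) +
        ENNReal.ofReal (partialRatio p h k y) * ENNReal.ofReal (h k y ^ 2) :=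
      hh2.add (hL.mul hh2)
    rw [lintegral_add_right _ (hmr.const_mul _), lintegral_const_mul _ hmr,
      lintegral_add_left hh2, h1]

end

end TVAR

/-! ### Autoregressive paths -/

namespace TVAR

variable {d n : ℕ}

/-- Innovations `y` numbered from `0` to `n - 1`, as a sequence numbered from `1` to `n`. -/
noncomputable def toSeq (y : Fin n → ℝ) (k : ℕ) : ℝ :=
  if hk : 0 < k ∧ k ≤ n then y ⟨k - 1, by omega⟩ else 0

theorem toSeq_succ (y : Fin n → ℝ) {k : ℕ} (hk : k < n) : toSeq y (k + 1) = y ⟨k, hk⟩ := by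
  have : 0 < k + 1 ∧ k + 1 ≤ n := by omega
  simp [toSeq, this]

theorem measurable_toSeq (k : ℕ) : Measurable fun y : Fin n → ℝ => toSeq y k := by
  unfold toSeq
  split_ifs
  · exact measurable_pi_apply _
  · exact measurable_const

theorem state_congr (θ : ℝ → EuclideanSpace ℝ (Fin d)) (σ : ℝ → ℝ) (n : ℕ)
    (x₀ : EuclideanSpace ℝ (Fin d)) {e e' : ℕ → ℝ} {k : ℕ}
    (h : ∀ i < k, e (i + 1) = e' (i + 1)) : state θ σ n x₀ e k = state θ σ n x₀ e' k := by
  induction k with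
  | zero => rfl
  | succ k ih => rw [state, state, ih fun i hi => h i (by omega), h k (by omega)]

theorem sample_congr (θ : ℝ → EuclideanSpace ℝ (Fin d)) (σ : ℝ → ℝ) (n : ℕ)
    (x₀ : EuclideanSpace ℝ (Fin d)) {e e' : ℕ → ℝ}
    (h : ∀ i < n, e (i + 1) = e' (i + 1)) : sample θ σ n x₀ e = sample θ σ n x₀ e' := by
  unfold sample obs
  congr 1
  ext k
  rw [state_congr θ σ n x₀ fun i hi => h i (by omega), h k k.2]

theorem measurable_coord (i : Fin d) : Measurable fun x : EuclideanSpace ℝ (Fin d) => x i :=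
  (EuclideanSpace.proj (𝕜 := ℝ) i).continuous.measurable

theorem measurable_state {α : Type*} [MeasurableSpace α] (θ : ℝ → EuclideanSpace ℝ (Fin d))
    (σ : ℝ → ℝ) (n : ℕ) {x : α → EuclideanSpace ℝ (Fin d)} {e : α → ℕ → ℝ}
    (hx : Measurable x) (he : ∀ k, Measurable fun a => e a k) (k : ℕ) :
    Measurable fun a => state θ σ n (x a) (e a) k := by
  induction k with
  | zero => exact hx
  | succ k ih =>
    refine (WithLp.measurable_toLp 2 _).comp (measurable_pi_lambda _ fun i => ?_)
    split_ifs
    · exact (Finset.measurable_fun_sum _ fun i _ =>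
        ((measurable_coord i).comp ih).const_mul _).add ((he _).const_mul _)
    · exact (measurable_coord _).comp ih

theorem measurable_sample {α : Type*} [MeasurableSpace α] (θ : ℝ → EuclideanSpace ℝ (Fin d))
    (σ : ℝ → ℝ) (n : ℕ) {x : α → EuclideanSpace ℝ (Fin d)} {e : α → ℕ → ℝ}
    (hx : Measurable x) (he : ∀ k, Measurable fun a => e a k) :
    Measurable fun a => sample θ σ n (x a) (e a) := by
  refine hx.prodMk (measurable_pi_lambda _ fun k => ?_)
  exact (Finset.measurable_fun_sum _ fun i _ =>
    ((measurable_coord i).comp (measurable_state θ σ n hx he k)).const_mul _).add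
      ((he _).const_mul _)

/-- The prediction `θᵀ 𝐗_j / s` of the observation of index `j`, in units of the constant noise
level `s`, as a function of the observations `X_k = s y_k`. These observations are the path of the
autoregression with coefficients `0` and innovations `y`. -/
noncomputable def drift (θ : ℝ → EuclideanSpace ℝ (Fin d)) (s : ℝ) (x₀ : EuclideanSpace ℝ (Fin d))
    (j : Fin n) (y : Fin n → ℝ) : ℝ :=
  s⁻¹ * ∑ i, θ ((j : ℕ) / n) i * state 0 (fun _ => s) n x₀ (toSeq y) j i

theorem isPredictable_drift (θ : ℝ → EuclideanSpace ℝ (Fin d)) (s : ℝ)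
    (x₀ : EuclideanSpace ℝ (Fin d)) : IsPredictable (drift (n := n) θ s x₀) := by
  intro j i hji y e
  have h : ∀ k < (j : ℕ), toSeq (Function.update y i e) (k + 1) = toSeq y (k + 1) := by
    intro k hk
    have hkn : k < n := by omega
    rw [toSeq_succ _ hkn, toSeq_succ _ hkn, Function.update_of_ne]
    rw [Ne, Fin.ext_iff]
    have : (j : ℕ) ≤ i := hji
    simp only
    omega
  rw [drift, state_congr _ _ _ _ h, drift]

theorem measurable_drift (θ : ℝ → EuclideanSpace ℝ (Fin d)) (s : ℝ)
    (x₀ : EuclideanSpace ℝ (Fin d)) (j : Fin n) : Measurable (drift θ s x₀ j) :=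
  (Finset.measurable_fun_sum _ fun i _ => ((measurable_coord i).comp
    (measurable_state 0 _ n measurable_const measurable_toSeq j)).const_mul _).const_mul _

/-- Feeding the autoregression of coefficient `θ` with the reconstructed innovations gives back the
observed path. -/
theorem state_unshift (θ : ℝ → EuclideanSpace ℝ (Fin d)) {s : ℝ} (hs : s ≠ 0)
    (x₀ : EuclideanSpace ℝ (Fin d)) (y : Fin n → ℝ) {k m : ℕ} (hkm : k ≤ m) (hm : m ≤ n) :
    state θ (fun _ => s) n x₀ (toSeq (unshift (drift θ s x₀) m y)) k =
      state 0 (fun _ => s) n x₀ (toSeq y) k := by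
  induction k with
  | zero => rfl
  | succ k ih =>
    have hk : k < n := by omega
    have hk' : k < m := by omega
    rw [state, state, ih hk'.le, toSeq_succ _ hk, toSeq_succ _ hk]
    simp [unshift, hk', drift, mul_sub, hs]

theorem sample_unshift (θ : ℝ → EuclideanSpace ℝ (Fin d)) {s : ℝ} (hs : s ≠ 0)
    (x₀ : EuclideanSpace ℝ (Fin d)) (y : Fin n → ℝ) :
    sample θ (fun _ => s) n x₀ (toSeq (unshift (drift θ s x₀) n y)) =
      sample 0 (fun _ => s) n x₀ (toSeq y) := by
  unfold sample obs
  congr 1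
  ext k
  rw [state_unshift θ hs x₀ y k.2.le le_rfl, toSeq_succ _ k.2, toSeq_succ _ k.2]
  simp [unshift, drift, mul_sub, hs]

/-! ### Second moments -/

theorem sum_mul_sq_le (v x : EuclideanSpace ℝ (Fin d)) :
    (∑ i, v i * x i) ^ 2 ≤ ‖v‖ ^ 2 * ∑ i, x i ^ 2 := by
  rw [EuclideanSpace.real_norm_sq_eq]
  exact Finset.sum_mul_sq_le_sq_mul_sq _ _ _

theorem lintegral_sum_mul_sq_le {α : Type*} [MeasurableSpace α] {ν : Measure α}
    (v : EuclideanSpace ℝ (Fin d)) {x : α → EuclideanSpace ℝ (Fin d)} (hx : Measurable x)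
    {B : ℝ≥0∞} (hB : ∀ i, ∫⁻ a, ENNReal.ofReal (x a i ^ 2) ∂ν ≤ B) :
    ∫⁻ a, ENNReal.ofReal ((∑ i, v i * x a i) ^ 2) ∂ν ≤ ENNReal.ofReal (‖v‖ ^ 2) * (d * B) := by
  have hm : ∀ i, Measurable fun a => ENNReal.ofReal (x a i ^ 2) := fun i =>
    (((measurable_coord i).comp hx).pow_const 2).ennreal_ofReal
  calc ∫⁻ a, ENNReal.ofReal ((∑ i, v i * x a i) ^ 2) ∂ν
      ≤ ∫⁻ a, ENNReal.ofReal (‖v‖ ^ 2) * ∑ i, ENNReal.ofReal (x a i ^ 2) ∂ν := by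
        refine lintegral_mono fun a => ?_
        rw [← ENNReal.ofReal_sum_of_nonneg fun i _ => sq_nonneg _,
          ← ENNReal.ofReal_mul (sq_nonneg _)]
        exact ENNReal.ofReal_le_ofReal (sum_mul_sq_le v (x a))
    _ = ENNReal.ofReal (‖v‖ ^ 2) * ∑ i, ∫⁻ a, ENNReal.ofReal (x a i ^ 2) ∂ν := by
        rw [lintegral_const_mul _ (Finset.measurable_fun_sum _ fun i _ => hm i),
          lintegral_finsetSum _ fun i _ => hm i]
    _ ≤ _ := by
        gcongr
        exact (Finset.sum_le_sum fun i _ => hB i).trans (by simp)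

section

variable {μ : Fin n → Measure ℝ} [∀ j, IsProbabilityMeasure (μ j)]

/-- A contraction argument: if `‖θ‖² ≤ 1 / (4 d)`, the second moments of the autoregression stay
below `4 s² + ‖x₀‖²`. -/
theorem lintegral_state_sq_le (hμ2 : ∀ j, ∫⁻ x, ENNReal.ofReal (x ^ 2) ∂μ j ≤ 1)
    {θ : ℝ → EuclideanSpace ℝ (Fin d)} (hθ : ∀ k < n, ‖θ ((k : ℕ) / n)‖ ^ 2 * d ≤ 1 / 4)
    (s : ℝ) (x₀ : EuclideanSpace ℝ (Fin d)) {k : ℕ} (hk : k ≤ n) (i : Fin d) :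
    ∫⁻ y, ENNReal.ofReal (state θ (fun _ => s) n x₀ (toSeq y) k i ^ 2) ∂Measure.pi μ ≤
      ENNReal.ofReal (4 * s ^ 2 + ‖x₀‖ ^ 2) := by
  induction k generalizing i with
  | zero =>
    simp only [state, lintegral_const, measure_univ, mul_one]
    refine ENNReal.ofReal_le_ofReal ?_
    have := EuclideanSpace.real_norm_sq_eq x₀
    have h2 : x₀ i ^ 2 ≤ ∑ i, x₀ i ^ 2 :=
      Finset.single_le_sum (f := fun i => x₀ i ^ 2) (fun i _ => sq_nonneg _) (Finset.mem_univ i)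
    nlinarith [sq_nonneg s]
  | succ k ih =>
    have ih := ih (by omega)
    simp only [state, push]
    split_ifs with hi
    · set B := 4 * s ^ 2 + ‖x₀‖ ^ 2 with hB
      have hst : Measurable fun y : Fin n → ℝ => state θ (fun _ => s) n x₀ (toSeq y) k :=
        measurable_state θ _ n measurable_const measurable_toSeq k
      have h1 := lintegral_sum_mul_sq_le (ν := Measure.pi μ) (θ ((k : ℕ) / n)) hst ih
      have h2 : ∫⁻ y : Fin n → ℝ, ENNReal.ofReal (y ⟨k, hk⟩ ^ 2) ∂Measure.pi μ ≤ 1 := by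
        have hF : Measurable fun y : Fin n → ℝ => ENNReal.ofReal (y ⟨k, hk⟩ ^ 2) :=
          ((measurable_pi_apply _).pow_const 2).ennreal_ofReal
        rw [← lintegral_pi_update μ ⟨k, hk⟩ hF]
        simp only [Function.update_self, lintegral_const, measure_univ, mul_one]
        exact hμ2 _
      have hm1 : Measurable fun y : Fin n → ℝ => ENNReal.ofReal
          ((∑ i, θ ((k : ℕ) / n) i * state θ (fun _ => s) n x₀ (toSeq y) k i) ^ 2) :=
        ((Finset.measurable_fun_sum _ fun i _ =>
          ((measurable_coord i).comp hst).const_mul _).pow_const 2).ennreal_ofReal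
      calc _ ≤ ∫⁻ y : Fin n → ℝ, (ENNReal.ofReal 2 * ENNReal.ofReal
              ((∑ i, θ ((k : ℕ) / n) i * state θ (fun _ => s) n x₀ (toSeq y) k i) ^ 2) +
              ENNReal.ofReal (2 * s ^ 2) * ENNReal.ofReal (y ⟨k, hk⟩ ^ 2)) ∂Measure.pi μ := by
            refine lintegral_mono fun y => ?_
            rw [← ENNReal.ofReal_mul (by positivity),
              ← ENNReal.ofReal_mul (by positivity),
              ← ENNReal.ofReal_add (by positivity) (by positivity), toSeq_succ y hk]
            refine ENNReal.ofReal_le_ofReal ?_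
            nlinarith [sq_nonneg ((∑ i, θ ((k : ℕ) / n) i *
              state θ (fun _ => s) n x₀ (toSeq y) k i) - s * y ⟨k, hk⟩)]
        _ ≤ ENNReal.ofReal 2 * (ENNReal.ofReal (‖θ ((k : ℕ) / n)‖ ^ 2) * (d * ENNReal.ofReal B)) +
              ENNReal.ofReal (2 * s ^ 2) * 1 := by
            rw [lintegral_add_left (hm1.const_mul _), lintegral_const_mul _ hm1,
              lintegral_const_mul _ ((measurable_pi_apply _).pow_const 2).ennreal_ofReal]
            gcongr
        _ ≤ ENNReal.ofReal B := by
            rw [← ENNReal.ofReal_natCast d,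
              ← ENNReal.ofReal_mul (by positivity), ← ENNReal.ofReal_mul (by positivity),
              ← ENNReal.ofReal_mul (by positivity), mul_one,
              ← ENNReal.ofReal_add (by positivity) (by positivity)]
            refine ENNReal.ofReal_le_ofReal ?_
            have hB0 : 0 ≤ B := by positivity
            nlinarith [mul_le_mul_of_nonneg_right (hθ k hk) hB0, sq_nonneg ‖x₀‖]
    · exact ih _

/-- The Hellinger affinity between the laws, given the initial condition, of the samples of
coefficients `0` and `θ` and of noise level `s`. -/
theorem one_le_affinity_drift {p : Fin n → ℝ → ℝ} (hp0 : ∀ j x, 0 ≤ p j x)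
    (hac : ∀ j a b, AbsolutelyContinuousOnInterval (p j) a b)
    (hμ : ∀ j, μ j = volume.withDensity fun x => ENNReal.ofReal (p j x)) {J : ℝ≥0∞}
    (hJ : ∀ j, ∫⁻ x, fisherDensity (p j) x ≤ J)
    (hμ2 : ∀ j, ∫⁻ x, ENNReal.ofReal (x ^ 2) ∂μ j ≤ 1)
    {θ : ℝ → EuclideanSpace ℝ (Fin d)} (hθ : ∀ k < n, ‖θ ((k : ℕ) / n)‖ ^ 2 * d ≤ 1 / 4)
    {s : ℝ} (hs : s ≠ 0) (x₀ : EuclideanSpace ℝ (Fin d)) :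
    1 ≤ (∫⁻ y, ENNReal.ofReal √(partialRatio p (drift θ s x₀) n y) ∂Measure.pi μ) +
      (∑ j : Fin n, ENNReal.ofReal (‖θ ((j : ℕ) / n)‖ ^ 2)) *
        (J / 8 * ENNReal.ofReal (s⁻¹ ^ 2) * d * ENNReal.ofReal (4 * s ^ 2 + ‖x₀‖ ^ 2)) := by
  have hp : ∀ j, Measurable (p j) := fun j =>
    (continuous_of_absolutelyContinuousOnInterval (hac j)).measurable
  have hh := isPredictable_drift (n := n) θ s x₀
  have hm := measurable_drift (n := n) θ s x₀
  refine (one_le_lintegral_sqrt_partialRatio hp0 hac hμ hh hm hJ le_rfl).trans ?_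
  rw [Finset.sum_mul]
  refine add_le_add le_rfl ?_
  rw [Finset.filter_true_of_mem fun j _ => j.2]
  refine Finset.sum_le_sum fun j _ => ?_
  set B := ENNReal.ofReal (4 * s ^ 2 + ‖x₀‖ ^ 2)
  set Q := ENNReal.ofReal (‖θ ((j : ℕ) / n)‖ ^ 2)
  have bound : ∀ θ' : ℝ → EuclideanSpace ℝ (Fin d),
      (∀ k < n, ‖θ' ((k : ℕ) / n)‖ ^ 2 * d ≤ 1 / 4) →
      ∫⁻ y, ENNReal.ofReal ((s⁻¹ * ∑ i, θ ((j : ℕ) / n) i *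
        state θ' (fun _ => s) n x₀ (toSeq y) j i) ^ 2) ∂Measure.pi μ ≤
        ENNReal.ofReal (s⁻¹ ^ 2) * (Q * (d * B)) := by
    intro θ' hθ'
    have hst : Measurable fun y : Fin n → ℝ => state θ' (fun _ => s) n x₀ (toSeq y) j :=
      measurable_state θ' _ n measurable_const measurable_toSeq j
    have h1 := lintegral_sum_mul_sq_le (ν := Measure.pi μ) (θ ((j : ℕ) / n)) hst
      fun i => lintegral_state_sq_le hμ2 hθ' s x₀ j.2.le i
    simp_rw [mul_pow, ENNReal.ofReal_mul (sq_nonneg s⁻¹)]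
    rw [lintegral_const_mul']
    · gcongr
    · exact ENNReal.ofReal_ne_top
  have b0 : ∫⁻ y, ENNReal.ofReal (drift θ s x₀ j y ^ 2) ∂Measure.pi μ ≤
      ENNReal.ofReal (s⁻¹ ^ 2) * (Q * (d * B)) := bound 0 (by simp)
  have b1 : ∫⁻ y, ENNReal.ofReal (partialRatio p (drift θ s x₀) j y) *
      ENNReal.ofReal (drift θ s x₀ j y ^ 2) ∂Measure.pi μ ≤
      ENNReal.ofReal (s⁻¹ ^ 2) * (Q * (d * B)) := by
    have hst : Measurable fun y : Fin n → ℝ => state θ (fun _ => s) n x₀ (toSeq y) j :=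
      measurable_state θ _ n measurable_const measurable_toSeq j
    have hψ : Measurable fun y : Fin n → ℝ => ENNReal.ofReal ((s⁻¹ * ∑ i, θ ((j : ℕ) / n) i *
        state θ (fun _ => s) n x₀ (toSeq y) j i) ^ 2) :=
      (((Finset.measurable_fun_sum _ fun i _ =>
        ((measurable_coord i).comp hst).const_mul _).const_mul _).pow_const 2).ennreal_ofReal
    have := lintegral_partialRatio_mul_le hp0 hp hμ hh hm j.2.le hψ
    simp_rw [state_unshift θ hs x₀ _ le_rfl j.2.le] at this
    exact this.trans (bound θ hθ)
  calc J / 16 * _ ≤ J / 16 * (ENNReal.ofReal (s⁻¹ ^ 2) * (Q * (d * B)) +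
        ENNReal.ofReal (s⁻¹ ^ 2) * (Q * (d * B))) := by gcongr
    _ = (J / 16 * 2) * (ENNReal.ofReal (s⁻¹ ^ 2) * (Q * (d * B))) := by ring
    _ = Q * (J / 8 * ENNReal.ofReal (s⁻¹ ^ 2) * d * B) := by
      have : J / 16 * 2 = J / 8 := by
        rw [show (16 : ℝ≥0∞) = 8 * 2 by norm_num, div_eq_mul_inv, div_eq_mul_inv,
          ENNReal.mul_inv (by simp) (by simp), mul_assoc, mul_assoc,
          ENNReal.inv_mul_cancel (by norm_num) (by norm_num), mul_one]
      rw [this]; ring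

end

end TVAR

/-! ### The perturbation of the coefficient -/

namespace TVAR

/-- A smooth function on `ℝ` with values in `[0, 1]`, equal to `1` at `0` and vanishing outside
`(-1, 1)`. -/
noncomputable def bump : ContDiffBump (0 : ℝ) := ⟨1 / 2, 1, by norm_num, by norm_num⟩

theorem bump_zero : bump 0 = 1 := bump.one_of_mem_closedBall (by simp [bump.rIn_pos.le])

theorem bump_eq_zero {x : ℝ} (hx : 1 ≤ |x|) : bump x = 0 :=
  bump.zero_of_le_dist (by simpa [bump] using hx)

theorem exists_bound_iteratedDeriv_bump (m : ℕ) : ∃ C, ∀ x, ‖iteratedDeriv m bump x‖ ≤ C := by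
  have hc : ContDiff ℝ m bump := bump.contDiff
  have hs : HasCompactSupport (iteratedDeriv m bump) := by
    induction m with
    | zero => simpa using bump.hasCompactSupport
    | succ m ih => rw [iteratedDeriv_succ]; exact (ih bump.contDiff).deriv
  exact hs.exists_bound_of_continuous (hc.continuous_iteratedDeriv m le_rfl)

/-- Every derivative of the bump function is bounded and Lipschitz, hence Hölder. -/
theorem exists_holder_iteratedDeriv_bump (m : ℕ) {a : ℝ} (ha : 0 < a) (ha1 : a ≤ 1) :
    ∃ K, ∀ x y, |iteratedDeriv m bump x - iteratedDeriv m bump y| ≤ K * |x - y| ^ a := by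
  obtain ⟨C, hC⟩ := exists_bound_iteratedDeriv_bump m
  obtain ⟨C', hC'⟩ := exists_bound_iteratedDeriv_bump (m + 1)
  have h0 : 0 ≤ C := (norm_nonneg _).trans (hC 0)
  have h0' : 0 ≤ C' := (norm_nonneg _).trans (hC' 0)
  have hc : ContDiff ℝ (m + 1 : ℕ) bump := bump.contDiff
  have hd : Differentiable ℝ (iteratedDeriv m bump) :=
    hc.differentiable_iteratedDeriv m (by exact_mod_cast m.lt_succ_self)
  refine ⟨2 * C + C', fun x y => ?_⟩
  rcases le_total |x - y| 1 with h | h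
  · have h1 := Convex.norm_image_sub_le_of_norm_deriv_le (s := Set.univ)
      (f := iteratedDeriv m bump) (C := C') (fun z _ => hd z)
      (fun z _ => by simpa only [iteratedDeriv_succ] using hC' z) convex_univ
      (Set.mem_univ y) (Set.mem_univ x)
    have h2 : |x - y| ≤ |x - y| ^ a := by
      simpa using Real.rpow_le_rpow_of_exponent_ge_of_imp (abs_nonneg (x - y)) h ha1
        (fun _ h => absurd h one_ne_zero)
    simp only [Real.norm_eq_abs] at h1
    nlinarith [mul_le_mul_of_nonneg_left h2 h0', mul_nonneg h0 (abs_nonneg (x - y))]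
  · have h1 : 1 ≤ |x - y| ^ a := Real.one_le_rpow h ha.le
    have h2 := norm_sub_le (iteratedDeriv m bump x) (iteratedDeriv m bump y)
    have h3 := hC x
    have h4 := hC y
    simp only [Real.norm_eq_abs] at h2 h3 h4
    nlinarith

variable {d : ℕ}

/-- The perturbation of the zero coefficient: a bump of height `τ b ^ β` and width `b` around `t`
in the direction `u`. -/
noncomputable def bumpCoeff (β τ b t : ℝ) (u : EuclideanSpace ℝ (Fin d)) (s : ℝ) :
    EuclideanSpace ℝ (Fin d) :=
  (τ * b ^ β * bump (b⁻¹ * (s - t))) • u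

theorem bumpCoeff_self (β τ b t : ℝ) (u : EuclideanSpace ℝ (Fin d)) :
    bumpCoeff β τ b t u t = (τ * b ^ β) • u := by
  simp [bumpCoeff, bump_zero]

theorem norm_bumpCoeff_le {β τ b : ℝ} (hτ : 0 ≤ τ) (hb : 0 < b) (t : ℝ)
    {u : EuclideanSpace ℝ (Fin d)} (hu : ‖u‖ = 1) (s : ℝ) :
    ‖bumpCoeff β τ b t u s‖ ≤ τ * b ^ β := by
  have h0 : 0 ≤ τ * b ^ β := by positivity
  rw [bumpCoeff, norm_smul, hu, mul_one, norm_mul, Real.norm_of_nonneg h0,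
    Real.norm_of_nonneg bump.nonneg]
  exact mul_le_of_le_one_right h0 bump.le_one

theorem norm_bumpCoeff_le_of_le_one {β τ b : ℝ} (hβ : 0 ≤ β) (hτ : 0 ≤ τ) (hb : 0 < b)
    (hb1 : b ≤ 1) (t : ℝ) {u : EuclideanSpace ℝ (Fin d)} (hu : ‖u‖ = 1) (s : ℝ) :
    ‖bumpCoeff β τ b t u s‖ ≤ τ :=
  (norm_bumpCoeff_le hτ hb t hu s).trans
    (mul_le_of_le_one_right hτ (Real.rpow_le_one hb.le hb1 hβ))

theorem contDiff_bumpCoeff (β τ b t : ℝ) (u : EuclideanSpace ℝ (Fin d)) (m : ℕ) :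
    ContDiff ℝ m (bumpCoeff β τ b t u) := by
  have hw : ContDiff ℝ m bump := bump.contDiff
  have h1 : ContDiff ℝ m fun s => bump (b⁻¹ * (s - t)) :=
    hw.comp (contDiff_const.mul (contDiff_id.sub contDiff_const))
  exact (contDiff_const.mul h1).smul contDiff_const

theorem iteratedDeriv_bumpCoeff (β τ b t : ℝ) (u : EuclideanSpace ℝ (Fin d)) (m : ℕ) (s : ℝ) :
    iteratedDeriv m (bumpCoeff β τ b t u) s =
      (τ * b ^ β * (b⁻¹ ^ m * iteratedDeriv m bump (b⁻¹ * (s - t)))) • u := by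
  have hw : ContDiff ℝ m bump := bump.contDiff
  have h1 : ContDiff ℝ m fun s => bump (b⁻¹ * (s - t)) :=
    hw.comp (contDiff_const.mul (contDiff_id.sub contDiff_const))
  have h2 : iteratedDeriv m (fun s => bump (b⁻¹ * (s - t))) s =
      b⁻¹ ^ m * iteratedDeriv m bump (b⁻¹ * (s - t)) := by
    rw [iteratedDeriv_comp_sub_const m (fun z => bump (b⁻¹ * z)) t,
      iteratedDeriv_comp_const_mul hw]
  have h3 := iteratedDeriv_smul_const (n := m) (x := s)
    (f := fun s => τ * b ^ β * bump (b⁻¹ * (s - t))) (contDiff_const.mul h1).contDiffAt u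
  rw [iteratedDeriv_const_mul_field, h2] at h3
  exact h3

theorem bumpCoeff_mem_lipBall {β L τ b : ℝ} {K : ℝ} (hβ : 0 < β)
    (hK : ∀ x y, |iteratedDeriv (⌈β⌉₊ - 1) bump x - iteratedDeriv (⌈β⌉₊ - 1) bump y| ≤
      K * |x - y| ^ (β - ((⌈β⌉₊ - 1 : ℕ) : ℝ)))
    (hτ : 0 ≤ τ) (hτL : τ ≤ L) (hτK : τ * K ≤ L) (hb : 0 < b) (hb1 : b ≤ 1) (t : ℝ)
    {u : EuclideanSpace ℝ (Fin d)} (hu : ‖u‖ = 1) :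
    bumpCoeff β τ b t u ∈ LipBall d β L := by
  set m := ⌈β⌉₊ - 1
  refine ⟨(contDiff_bumpCoeff β τ b t u m).contDiffOn, fun s hs s' hs' => ?_, fun s _ =>
    (norm_bumpCoeff_le_of_le_one hβ.le hτ hb hb1 t hu s).trans hτL⟩
  have hI : ∀ s ∈ Set.Icc (0 : ℝ) 1, iteratedDerivWithin m (bumpCoeff β τ b t u) (Set.Icc 0 1) s =
      iteratedDeriv m (bumpCoeff β τ b t u) s := fun s hs =>
    iteratedDerivWithin_eq_iteratedDeriv (uniqueDiffOn_Icc one_pos)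
      (contDiff_bumpCoeff β τ b t u m).contDiffAt hs
  rw [hI s hs, hI s' hs', iteratedDeriv_bumpCoeff, iteratedDeriv_bumpCoeff, ← sub_smul, norm_smul,
    hu, mul_one, ← mul_sub, ← mul_sub, norm_mul (τ * b ^ β), norm_mul (b⁻¹ ^ m),
    Real.norm_of_nonneg (by positivity : 0 ≤ τ * b ^ β),
    Real.norm_of_nonneg (by positivity : 0 ≤ b⁻¹ ^ m), Real.norm_eq_abs]
  change _ ≤ L * |s' - s| ^ (β - (m : ℝ))
  have h1 := hK (b⁻¹ * (s' - t)) (b⁻¹ * (s - t))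
  rw [← mul_sub, sub_sub_sub_cancel_right, abs_mul, abs_of_pos (inv_pos.2 hb),
    Real.mul_rpow (inv_pos.2 hb).le (abs_nonneg _)] at h1
  -- The powers of `b` cancel: `β = m + a`, where `a` is the Hölder exponent.
  have h2 : b ^ β * (b⁻¹ ^ m * b⁻¹ ^ (β - m)) = 1 := by
    rw [← Real.rpow_natCast b⁻¹ m, ← Real.rpow_add (inv_pos.2 hb), add_sub_cancel,
      ← Real.mul_rpow hb.le (inv_pos.2 hb).le, mul_inv_cancel₀ hb.ne', Real.one_rpow]
  calc τ * b ^ β * (b⁻¹ ^ m * _)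
      ≤ τ * b ^ β * (b⁻¹ ^ m * (K * (b⁻¹ ^ (β - m) * |s' - s| ^ (β - m)))) := by gcongr
    _ = (τ * K) * |s' - s| ^ (β - m) * (b ^ β * (b⁻¹ ^ m * b⁻¹ ^ (β - m))) := by ring
    _ ≤ _ := by rw [h2, mul_one]; gcongr

/-- Small coefficients are stable. -/
theorem mem_stableClass_of_norm_le {ρ τ : ℝ} {θ : ℝ → EuclideanSpace ℝ (Fin d)}
    (hτ0 : 0 ≤ τ) (hθ : ∀ s, ‖θ s‖ ≤ τ) (hτ : τ * ∑ j : Fin d, ρ⁻¹ ^ ((j : ℕ) + 1) < 1) :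
    θ ∈ StableClass d ρ := by
  intro t _ z hz h0
  have h1 : (1 : ℂ) = ∑ j : Fin d, (θ t j : ℂ) * z ^ ((j : ℕ) + 1) := sub_eq_zero.1 h0
  have h2 : (1 : ℝ) ≤ ∑ j : Fin d, τ * ρ⁻¹ ^ ((j : ℕ) + 1) := by
    calc (1 : ℝ) = ‖∑ j : Fin d, (θ t j : ℂ) * z ^ ((j : ℕ) + 1)‖ := by rw [← h1]; simp
      _ ≤ ∑ j : Fin d, ‖(θ t j : ℂ) * z ^ ((j : ℕ) + 1)‖ := norm_sum_le _ _
      _ ≤ _ := by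
        refine Finset.sum_le_sum fun j _ => ?_
        rw [norm_mul, norm_pow, Complex.norm_real]
        gcongr
        exact (PiLp.norm_apply_le (θ t) j).trans (hθ t)
  rw [← Finset.mul_sum] at h2
  linarith

/-- There are at most `2 n b + 1` design points within distance `b` of `t`. -/
theorem card_filter_near_le {n : ℕ} (hn : 1 ≤ n) {b : ℝ} (hb : 0 ≤ b) (t : ℝ) :
    ((Finset.univ.filter fun j : Fin n => |((j : ℕ) : ℝ) / n - t| < b).card : ℝ) ≤
      2 * n * b + 1 := by
  have hn0 : (0 : ℝ) < n := by exact_mod_cast hn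
  set S := Finset.univ.filter fun j : Fin n => |((j : ℕ) : ℝ) / n - t| < b
  have h1 : S.card ≤ (Finset.Icc ⌈n * (t - b)⌉ ⌊n * (t + b)⌋).card := by
    refine Finset.card_le_card_of_injOn (fun j => ((j : ℕ) : ℤ)) (fun j hj => ?_) ?_
    · have hj : |((j : ℕ) : ℝ) / n - t| < b := (Finset.mem_filter.1 hj).2
      rw [abs_lt] at hj
      have e : ((j : ℕ) : ℝ) = n * (((j : ℕ) : ℝ) / n) := by field_simp
      rw [Finset.coe_Icc, Set.mem_Icc, Int.ceil_le, Int.le_floor, Int.cast_natCast, e]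
      constructor <;> refine mul_le_mul_of_nonneg_left ?_ hn0.le <;> linarith [hj.1, hj.2]
    · intro i _ j _ hij
      exact Fin.ext (Int.ofNat_inj.1 hij)
  rw [Int.card_Icc] at h1
  have h2 : (S.card : ℝ) ≤ ((⌊n * (t + b)⌋ + 1 - ⌈n * (t - b)⌉).toNat : ℝ) := by exact_mod_cast h1
  refine h2.trans ?_
  have h3 : (((⌊n * (t + b)⌋ + 1 - ⌈n * (t - b)⌉).toNat : ℤ) : ℝ) =
      ((max (⌊n * (t + b)⌋ + 1 - ⌈n * (t - b)⌉) 0 : ℤ) : ℝ) := by rw [Int.toNat_eq_max]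
  rw [Int.cast_natCast] at h3
  rw [h3, Int.cast_max]
  refine max_le ?_ (by push_cast; positivity)
  push_cast
  have := Int.floor_le (n * (t + b))
  have := Int.le_ceil (n * (t - b))
  linarith

theorem sum_norm_sq_bumpCoeff_le {n : ℕ} (hn : 1 ≤ n) {β τ b : ℝ} (hτ : 0 ≤ τ) (hb : 0 < b)
    (hnb : 1 ≤ n * b) (t : ℝ) {u : EuclideanSpace ℝ (Fin d)} (hu : ‖u‖ = 1) :
    ∑ j : Fin n, ‖bumpCoeff β τ b t u ((j : ℕ) / n)‖ ^ 2 ≤ 3 * (n * b) * (τ * b ^ β) ^ 2 := by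
  have h1 : ∀ j : Fin n, ‖bumpCoeff β τ b t u ((j : ℕ) / n)‖ ^ 2 ≤
      if |((j : ℕ) : ℝ) / n - t| < b then (τ * b ^ β) ^ 2 else 0 := by
    intro j
    split_ifs with h
    · gcongr
      exact norm_bumpCoeff_le hτ hb t hu _
    · rw [bumpCoeff, bump_eq_zero]
      · simp
      · rw [abs_mul, abs_of_pos (inv_pos.2 hb), inv_mul_eq_div, le_div_iff₀ hb, one_mul]
        exact not_lt.1 h
  refine (Finset.sum_le_sum fun j _ => h1 j).trans ?_
  rw [← Finset.sum_filter, Finset.sum_const, nsmul_eq_mul]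
  refine mul_le_mul_of_nonneg_right ?_ (sq_nonneg _)
  have := card_filter_near_le hn hb.le t
  linarith

end TVAR

namespace TVAR

/-! ### Two-point bound -/

/-- The minimum over `φ` of `φ² + L (φ - c)²` is `c² L / (1 + L)`, which is compared with `√L`. -/
theorem sq_mul_sqrt_le {L : ℝ} (hL : 0 ≤ L) (c φ : ℝ) :
    c ^ 2 * √L ≤ 4 * (φ ^ 2 + L * (φ - c) ^ 2) + (c ^ 2 / 8 + L * (c ^ 2 / 8)) := by
  obtain ⟨r, hr, rfl⟩ : ∃ r, 0 ≤ r ∧ r ^ 2 = L := ⟨√L, Real.sqrt_nonneg _, Real.sq_sqrt hL⟩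
  rw [Real.sqrt_sq hr]
  have hT : 0 < 1 + r ^ 2 := by positivity
  refine le_of_mul_le_mul_left ?_ hT
  nlinarith [sq_nonneg ((1 + r ^ 2) * φ - r ^ 2 * c), sq_nonneg (c * (1 + r ^ 2 - 4 * r)),
    sq_nonneg (c * r)]

variable {d n : ℕ} {μ : Fin n → Measure ℝ} [∀ j, IsProbabilityMeasure (μ j)]
  {p : Fin n → ℝ → ℝ}

/-- If a statistic `f` estimates `0` under the coefficient `0` and `c` under the coefficient `θ`,
then the Hellinger affinity bounds the sum of the quadratic risks from below. -/
theorem affinity_le_risk (hp0 : ∀ j x, 0 ≤ p j x) (hp : ∀ j, Measurable (p j))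
    (hμ : ∀ j, μ j = volume.withDensity fun x => ENNReal.ofReal (p j x))
    (θ : ℝ → EuclideanSpace ℝ (Fin d)) {s : ℝ} (hs : s ≠ 0) (x₀ : EuclideanSpace ℝ (Fin d))
    {f : EuclideanSpace ℝ (Fin d) × (Fin n → ℝ) → ℝ} (hf : Measurable f) (c : ℝ) :
    ENNReal.ofReal (c ^ 2) *
        ∫⁻ y, ENNReal.ofReal √(partialRatio p (drift θ s x₀) n y) ∂Measure.pi μ ≤
      4 * ((∫⁻ y, ENNReal.ofReal (f (sample 0 (fun _ => s) n x₀ (toSeq y)) ^ 2) ∂Measure.pi μ) +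
        ∫⁻ y, ENNReal.ofReal ((f (sample θ (fun _ => s) n x₀ (toSeq y)) - c) ^ 2)
          ∂Measure.pi μ) + ENNReal.ofReal (c ^ 2 / 4) := by
  have hh := isPredictable_drift (n := n) θ s x₀
  have hm := measurable_drift (n := n) θ s x₀
  set L := partialRatio p (drift θ s x₀) n
  have hL0 : ∀ y, 0 ≤ L y := partialRatio_nonneg hp0 n
  have hLm : Measurable fun y => ENNReal.ofReal (L y) :=
    (measurable_partialRatio hp hm n).ennreal_ofReal
  have hS : ∀ θ : ℝ → EuclideanSpace ℝ (Fin d), Measurable fun y : Fin n → ℝ =>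
      f (sample θ (fun _ => s) n x₀ (toSeq y)) := fun θ =>
    hf.comp (measurable_sample θ _ n measurable_const measurable_toSeq)
  set φ : (Fin n → ℝ) → ℝ := fun y => f (sample 0 (fun _ => s) n x₀ (toSeq y)) with hφ
  have hφm : Measurable φ := hS 0
  have hψ : Measurable fun y : Fin n → ℝ =>
      ENNReal.ofReal ((f (sample θ (fun _ => s) n x₀ (toSeq y)) - c) ^ 2) :=
    (((hS θ).sub_const c).pow_const 2).ennreal_ofReal
  have h1 : ∫⁻ y, ENNReal.ofReal (L y) * ENNReal.ofReal ((φ y - c) ^ 2) ∂Measure.pi μ ≤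
      ∫⁻ y, ENNReal.ofReal ((f (sample θ (fun _ => s) n x₀ (toSeq y)) - c) ^ 2) ∂Measure.pi μ := by
    have := lintegral_partialRatio_mul_le hp0 hp hμ hh hm le_rfl hψ
    simpa only [sample_unshift θ hs x₀] using this
  have h2 : ∫⁻ y, ENNReal.ofReal (L y) ∂Measure.pi μ ≤ 1 := by
    simpa using lintegral_partialRatio_mul_le (ψ := fun _ => 1) hp0 hp hμ hh hm le_rfl
      measurable_const
  have hφ2 : Measurable fun y => ENNReal.ofReal (φ y ^ 2) := (hφm.pow_const 2).ennreal_ofReal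
  have hφc : Measurable fun y => ENNReal.ofReal (φ y ^ 2) +
      ENNReal.ofReal (L y) * ENNReal.ofReal ((φ y - c) ^ 2) :=
    hφ2.add (hLm.mul ((hφm.sub_const c).pow_const 2).ennreal_ofReal)
  calc ENNReal.ofReal (c ^ 2) * ∫⁻ y, ENNReal.ofReal √(L y) ∂Measure.pi μ
      = ∫⁻ y, ENNReal.ofReal (c ^ 2 * √(L y)) ∂Measure.pi μ := by
        simp_rw [ENNReal.ofReal_mul (sq_nonneg c)]
        rw [lintegral_const_mul' _ _ ENNReal.ofReal_ne_top]
    _ ≤ ∫⁻ y, (ENNReal.ofReal 4 * (ENNReal.ofReal (φ y ^ 2) +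
          ENNReal.ofReal (L y) * ENNReal.ofReal ((φ y - c) ^ 2)) +
          (ENNReal.ofReal (c ^ 2 / 8) + ENNReal.ofReal (L y) * ENNReal.ofReal (c ^ 2 / 8)))
          ∂Measure.pi μ := by
        refine lintegral_mono fun y => ?_
        have := hL0 y
        rw [← ENNReal.ofReal_mul this, ← ENNReal.ofReal_mul this,
          ← ENNReal.ofReal_add (by positivity) (by positivity),
          ← ENNReal.ofReal_add (by positivity) (by positivity),
          ← ENNReal.ofReal_mul (by positivity),
          ← ENNReal.ofReal_add (by positivity) (by positivity)]
        exact ENNReal.ofReal_le_ofReal (sq_mul_sqrt_le this c (φ y))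
    _ = ENNReal.ofReal 4 * ((∫⁻ y, ENNReal.ofReal (φ y ^ 2) ∂Measure.pi μ) +
          ∫⁻ y, ENNReal.ofReal (L y) * ENNReal.ofReal ((φ y - c) ^ 2) ∂Measure.pi μ) +
          (ENNReal.ofReal (c ^ 2 / 8) +
            (∫⁻ y, ENNReal.ofReal (L y) ∂Measure.pi μ) * ENNReal.ofReal (c ^ 2 / 8)) := by
        rw [lintegral_add_left (hφc.const_mul _), lintegral_const_mul _ hφc,
          lintegral_add_left hφ2, lintegral_add_left measurable_const, lintegral_const,
          measure_univ, mul_one, lintegral_mul_const _ hLm]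
    _ ≤ ENNReal.ofReal 4 * ((∫⁻ y, ENNReal.ofReal (φ y ^ 2) ∂Measure.pi μ) +
          ∫⁻ y, ENNReal.ofReal ((f (sample θ (fun _ => s) n x₀ (toSeq y)) - c) ^ 2)
            ∂Measure.pi μ) + (ENNReal.ofReal (c ^ 2 / 8) + 1 * ENNReal.ofReal (c ^ 2 / 8)) := by
        gcongr
    _ = _ := by
        rw [one_mul, ← ENNReal.ofReal_add (by positivity) (by positivity), show c ^ 2 / 8 + c ^ 2 / 8 = c ^ 2 / 4 by ring,
          show ENNReal.ofReal 4 = 4 by simp]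

/-- The two-point bound, integrated over the initial condition: the affinity is at least `1 / 2` on
average, and the remainder of `affinity_le_risk` costs `1 / 4`. -/
theorem le_risk_add_risk (hp0 : ∀ j x, 0 ≤ p j x)
    (hac : ∀ j a b, AbsolutelyContinuousOnInterval (p j) a b)
    (hμ : ∀ j, μ j = volume.withDensity fun x => ENNReal.ofReal (p j x)) {J : ℝ≥0∞}
    (hJ : ∀ j, ∫⁻ x, fisherDensity (p j) x ≤ J)
    (hμ2 : ∀ j, ∫⁻ x, ENNReal.ofReal (x ^ 2) ∂μ j ≤ 1)
    {θ : ℝ → EuclideanSpace ℝ (Fin d)} (hθ : ∀ k < n, ‖θ ((k : ℕ) / n)‖ ^ 2 * d ≤ 1 / 4)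
    {s : ℝ} (hs : s ≠ 0) (κ : Measure (EuclideanSpace ℝ (Fin d))) [IsProbabilityMeasure κ]
    (hsmall : (∑ j : Fin n, ENNReal.ofReal (‖θ ((j : ℕ) / n)‖ ^ 2)) *
      (J / 8 * ENNReal.ofReal (s⁻¹ ^ 2) * d * ∫⁻ x, ENNReal.ofReal (4 * s ^ 2 + ‖x‖ ^ 2) ∂κ) ≤
        ENNReal.ofReal (1 / 2))
    {f : EuclideanSpace ℝ (Fin d) × (Fin n → ℝ) → ℝ} (hf : Measurable f) (c : ℝ) :
    ENNReal.ofReal (c ^ 2 / 16) ≤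
      (∫⁻ x, ∫⁻ y, ENNReal.ofReal (f (sample 0 (fun _ => s) n x (toSeq y)) ^ 2)
        ∂Measure.pi μ ∂κ) +
      ∫⁻ x, ∫⁻ y, ENNReal.ofReal ((f (sample θ (fun _ => s) n x (toSeq y)) - c) ^ 2)
        ∂Measure.pi μ ∂κ := by
  have hp : ∀ j, Measurable (p j) := fun j =>
    (continuous_of_absolutelyContinuousOnInterval (hac j)).measurable
  set T := ∑ j : Fin n, ENNReal.ofReal (‖θ ((j : ℕ) / n)‖ ^ 2)
  set C := J / 8 * ENNReal.ofReal (s⁻¹ ^ 2) * d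
  set g : EuclideanSpace ℝ (Fin d) → ℝ≥0∞ := fun x => ENNReal.ofReal (4 * s ^ 2 + ‖x‖ ^ 2)
  have hg : Measurable g := ((measurable_norm.pow_const 2).const_add _).ennreal_ofReal
  set m₀ := fun x => ∫⁻ y, ENNReal.ofReal (f (sample 0 (fun _ => s) n x (toSeq y)) ^ 2)
    ∂Measure.pi μ
  set m₁ := fun x => ∫⁻ y, ENNReal.ofReal ((f (sample θ (fun _ => s) n x (toSeq y)) - c) ^ 2)
    ∂Measure.pi μ
  have hm₀ : Measurable m₀ := by
    refine Measurable.lintegral_prod_right' (ν := Measure.pi μ) (f := fun z =>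
      ENNReal.ofReal (f (sample 0 (fun _ => s) n z.1 (toSeq z.2)) ^ 2)) ?_
    exact ((hf.comp (measurable_sample 0 _ n measurable_fst
      fun k => (measurable_toSeq k).comp measurable_snd)).pow_const 2).ennreal_ofReal
  have hpt : ∀ x, ENNReal.ofReal (c ^ 2) ≤
      4 * (m₀ x + m₁ x) + (ENNReal.ofReal (c ^ 2 / 4) + ENNReal.ofReal (c ^ 2) * (T * C * g x)) := by
    intro x
    have h1 := one_le_affinity_drift hp0 hac hμ hJ hμ2 hθ hs x
    have h2 := affinity_le_risk hp0 hp hμ θ hs x hf c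
    calc ENNReal.ofReal (c ^ 2) ≤ ENNReal.ofReal (c ^ 2) * _ := le_mul_of_one_le_right' h1
      _ ≤ _ := by
        rw [mul_add, ← add_assoc, ← mul_assoc T]
        gcongr
  have hint := lintegral_mono (μ := κ) hpt
  rw [lintegral_const, measure_univ, mul_one,
    lintegral_add_right _ (((hg.const_mul _).const_mul _).const_add _),
    lintegral_const_mul' _ _ (by norm_num), lintegral_add_left hm₀,
    lintegral_add_left measurable_const, lintegral_const, measure_univ, mul_one,
    lintegral_const_mul _ (hg.const_mul _), lintegral_const_mul _ hg, mul_assoc T] at hint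
  have h3 : ENNReal.ofReal (c ^ 2) ≤ 4 * ((∫⁻ x, m₀ x ∂κ) + ∫⁻ x, m₁ x ∂κ) +
      ENNReal.ofReal (3 * c ^ 2 / 4) := by
    refine hint.trans (add_le_add le_rfl ?_)
    calc _ ≤ ENNReal.ofReal (c ^ 2 / 4) + ENNReal.ofReal (c ^ 2) * ENNReal.ofReal (1 / 2) := by
          gcongr
      _ = _ := by
          rw [← ENNReal.ofReal_mul (sq_nonneg c),
            ← ENNReal.ofReal_add (by positivity) (by positivity)]
          congr 1; ring
  have h4 : ENNReal.ofReal (c ^ 2) =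
      4 * ENNReal.ofReal (c ^ 2 / 16) + ENNReal.ofReal (3 * c ^ 2 / 4) := by
    have h : (4 : ℝ≥0∞) = ENNReal.ofReal 4 := by simp
    rw [h, ← ENNReal.ofReal_mul (by norm_num),
      ← ENNReal.ofReal_add (by positivity) (by positivity)]
    congr 1; ring
  rw [h4, ENNReal.add_le_add_iff_right ENNReal.ofReal_ne_top] at h3
  exact (ENNReal.mul_le_mul_iff_right (by norm_num) (by norm_num)).1 h3

end TVAR

namespace TVAR

/-! ### The law of the sample -/

section

variable {Ω : Type*} [MeasurableSpace Ω] {P : Measure Ω} {d : ℕ}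
  {ε : ℕ → ℕ → Ω → ℝ} {X₀ : ℕ → Ω → EuclideanSpace ℝ (Fin d)}

theorem AssumptionA1.map_eq [IsProbabilityMeasure P] {q : ℝ≥0∞} (hA1 : AssumptionA1 P q ε X₀) {n : ℕ} (hn : 1 ≤ n) :
    P.map (fun ω => (X₀ n ω, fun j : Fin n => ε n (j + 1) ω)) =
      (P.map (X₀ n)).prod (Measure.pi fun j : Fin n => P.map (ε n (j + 1))) := by
  have hmε : ∀ j : Fin n, Measurable (ε n (j + 1)) := fun j =>
    hA1.measurable_innov n _ (by omega) (by omega)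
  let e : Fin n → Finset.Icc 1 n := fun j => ⟨j + 1, Finset.mem_Icc.2 ⟨by omega, by omega⟩⟩
  have he : Function.Injective e := fun i j h => by
    have : (i : ℕ) + 1 = j + 1 := congrArg Subtype.val h
    exact Fin.ext (by omega)
  have h1 : iIndepFun (fun j : Fin n => ε n (j + 1)) P := (hA1.indep_innov n hn).precomp he
  have h2 : IndepFun (X₀ n) (fun ω (j : Fin n) => ε n (j + 1) ω) P :=
    (hA1.indep_init n hn).comp (φ := id)
      (ψ := fun (z : Finset.Icc 1 n → ℝ) (j : Fin n) => z (e j)) measurable_id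
      (measurable_pi_lambda _ fun j => measurable_pi_apply _)
  rw [(indepFun_iff_map_prod_eq_prod_map_map (hA1.measurable_init n hn).aemeasurable
    (measurable_pi_lambda _ hmε).aemeasurable).1 h2,
    h1.map_fun_eq_pi_map fun j => (hmε j).aemeasurable]

theorem AssumptionA1.lintegral_sample [IsProbabilityMeasure P] {q : ℝ≥0∞}
    (hA1 : AssumptionA1 P q ε X₀) {n : ℕ} (hn : 1 ≤ n) (θ : ℝ → EuclideanSpace ℝ (Fin d)) (σ : ℝ → ℝ)
    {G : EuclideanSpace ℝ (Fin d) × (Fin n → ℝ) → ℝ≥0∞} (hG : Measurable G) :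
    ∫⁻ ω, G (sample θ σ n (X₀ n ω) fun k => ε n k ω) ∂P =
      ∫⁻ x, ∫⁻ y, G (sample θ σ n x (toSeq y))
        ∂(Measure.pi fun j : Fin n => P.map (ε n (j + 1))) ∂(P.map (X₀ n)) := by
  have hmε : ∀ j : Fin n, Measurable (ε n (j + 1)) := fun j =>
    hA1.measurable_innov n _ (by omega) (by omega)
  have : ∀ j : Fin n, IsProbabilityMeasure (P.map (ε n (j + 1))) := fun j =>
    Measure.isProbabilityMeasure_map (hmε j).aemeasurable
  have hF : Measurable fun z : EuclideanSpace ℝ (Fin d) × (Fin n → ℝ) =>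
      G (sample θ σ n z.1 (toSeq z.2)) :=
    hG.comp (measurable_sample θ σ n measurable_fst
      fun k => (measurable_toSeq k).comp measurable_snd)
  rw [← lintegral_prod _ hF.aemeasurable, ← hA1.map_eq hn,
    lintegral_map hF ((hA1.measurable_init n hn).prodMk (measurable_pi_lambda _ hmε))]
  refine lintegral_congr fun ω => ?_
  rw [sample_congr θ σ n (X₀ n ω) (e' := toSeq fun j : Fin n => ε n (j + 1) ω)
    fun i hi => (toSeq_succ (fun j : Fin n => ε n (j + 1) ω) hi).symm]

theorem AssumptionA1.lintegral_innov_sq {q : ℝ≥0∞} (hA1 : AssumptionA1 P q ε X₀) {n k : ℕ}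
    (hk : 1 ≤ k) (hkn : k ≤ n) : ∫⁻ x, ENNReal.ofReal (x ^ 2) ∂(P.map (ε n k)) = 1 := by
  have hv := hA1.unit_variance n k hk hkn
  rw [variance, ENNReal.toReal_eq_one_iff, evariance] at hv
  simp only [hA1.mean_zero n k hk hkn, sub_zero] at hv
  have hm : Measurable fun x : ℝ => ENNReal.ofReal (x ^ 2) :=
    (measurable_id.pow_const 2).ennreal_ofReal
  rw [lintegral_map hm (hA1.measurable_innov n k hk hkn), ← hv]
  refine lintegral_congr fun ω => ?_
  rw [Real.enorm_eq_ofReal_abs, ← ENNReal.ofReal_pow (abs_nonneg _), sq_abs]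

theorem AssumptionA1.lintegral_init_sq_le (hA1 : AssumptionA1 P 2 ε X₀) {n : ℕ} (hn : 1 ≤ n) :
    ∫⁻ x, ENNReal.ofReal (‖x‖ ^ 2) ∂(P.map (X₀ n)) ≤
      (⨆ (n : ℕ) (_ : 1 ≤ n), eLpNorm (X₀ n) 2 P) ^ 2 := by
  have h1 := eLpNorm_nnreal_pow_eq_lintegral (f := X₀ n) (μ := P) (p := 2) (by norm_num)
  rw [lintegral_map (measurable_norm.pow_const 2).ennreal_ofReal (hA1.measurable_init n hn)]
  calc ∫⁻ ω, ENNReal.ofReal (‖X₀ n ω‖ ^ 2) ∂P = eLpNorm (X₀ n) 2 P ^ 2 := by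
        simp only [ENNReal.coe_ofNat, NNReal.coe_ofNat, ENNReal.rpow_ofNat] at h1
        rw [h1]
        refine lintegral_congr fun ω => ?_
        rw [ENNReal.ofReal_pow (norm_nonneg _), ofReal_norm]
    _ ≤ _ := by
        gcongr
        exact le_iSup₂_of_le n hn le_rfl

theorem lintegral_fisherDensity_eq {p : ℝ → ℝ} (hp : Measurable p) {ξ : Ω → ℝ} (hξ : Measurable ξ)
    (hμ : P.map ξ = volume.withDensity fun x => ENNReal.ofReal (p x)) :
    ∫⁻ x, fisherDensity p x =
      ∫⁻ ω, ENNReal.ofReal ((deriv p (ξ ω) / p (ξ ω)) ^ 2) ∂P := by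
  have hm : Measurable fun x => ENNReal.ofReal ((deriv p x / p x) ^ 2) :=
    (((measurable_deriv p).div hp).pow_const 2).ennreal_ofReal
  rw [← lintegral_map hm hξ, hμ, lintegral_withDensity_eq_lintegral_mul _ hp.ennreal_ofReal hm]
  rfl

end

/-! ### The choice of the bandwidth -/

theorem eventually_lt_of_continuous {F : ℝ → ℝ} (hF : Continuous F) {B : ℝ} (hB : F 0 < B) :
    ∀ᶠ τ in nhdsWithin (0 : ℝ) (Set.Ioi 0), F τ < B :=
  (hF.tendsto 0).eventually (gt_mem_nhds hB) |>.filter_mono nhdsWithin_le_nhds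

/-- The bandwidth `b = n ^ (-1 / (1 + 2 β))` balances the height `b ^ β` of the perturbation and the
number `n b` of observations affected by it. -/
theorem exists_bandwidth {β : ℝ} (hβ : 0 < β) {n : ℕ} (hn : 1 ≤ n) :
    ∃ b : ℝ, 0 < b ∧ b ≤ 1 ∧ 1 ≤ n * b ∧ n * b * (b ^ β) ^ 2 = 1 ∧
      (b ^ β) ^ 2 = (n : ℝ) ^ (-(2 * β) / (1 + 2 * β)) := by
  have hn1 : (1 : ℝ) ≤ n := by exact_mod_cast hn
  have hn0 : (0 : ℝ) < n := by linarith
  have hd : (0 : ℝ) < 1 + 2 * β := by linarith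
  have h1 : (n : ℝ) * (n : ℝ) ^ (-1 / (1 + 2 * β)) = (n : ℝ) ^ (2 * β / (1 + 2 * β)) := by
    nth_rewrite 1 [← Real.rpow_one (n : ℝ)]
    rw [← Real.rpow_add hn0]
    congr 1; field_simp; ring
  have h2 : (((n : ℝ) ^ (-1 / (1 + 2 * β))) ^ β) ^ 2 = (n : ℝ) ^ (-(2 * β) / (1 + 2 * β)) := by
    rw [← Real.rpow_mul hn0.le, ← Real.rpow_natCast, ← Real.rpow_mul hn0.le]
    congr 1; push_cast; ring
  refine ⟨(n : ℝ) ^ (-1 / (1 + 2 * β)), by positivity, ?_, ?_, ?_, h2⟩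
  · exact Real.rpow_le_one_of_one_le_of_nonpos hn1
      (div_nonpos_of_nonpos_of_nonneg (by norm_num) hd.le)
  · rw [h1]
    exact Real.one_le_rpow hn1 (by positivity)
  · rw [h1, h2, ← Real.rpow_add hn0, ← add_div, add_neg_cancel, zero_div, Real.rpow_zero]

end TVAR

theorem theorem4 {Ω : Type*} [MeasurableSpace Ω] (P : Measure Ω) [IsProbabilityMeasure P]
    (d : ℕ) (hd : 1 ≤ d)
    (ε : ℕ → ℕ → Ω → ℝ) (X₀ : ℕ → Ω → EuclideanSpace ℝ (Fin d))
    (hA1 : TVAR.AssumptionA1 P 2 ε X₀) (hA2 : TVAR.AssumptionA2 P ε)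
    (β L ρ σm σp : ℝ) (hβ : 0 < β) (hL : 0 < L) (hρ : 0 < ρ) (hρ1 : ρ < 1)
    (hσm : 0 < σm) (hσ : σm ≤ σp) :
    ∃ α : ℝ, 0 < α ∧
      ∀ n : ℕ, 1 ≤ n → ∀ t ∈ Set.Icc (0 : ℝ) 1,
      ∀ δ : EuclideanSpace ℝ (Fin d) × (Fin n → ℝ) → EuclideanSpace ℝ (Fin d), Measurable δ →
        ENNReal.ofReal (α * (n : ℝ) ^ (-(2 * β) / (1 + 2 * β))) ≤
          ⨅ (u : EuclideanSpace ℝ (Fin d)) (_ : ‖u‖ = 1),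
            ⨆ p ∈ TVAR.ParamClass d β L ρ σm σp,
              TVAR.msemForm P
                (fun ω => δ (TVAR.sample p.1 p.2 n (X₀ n ω) (fun k => ε n k ω)) - p.1 t) u := by
  obtain ⟨p, hp, hJ⟩ := hA2
  set J : ℝ≥0∞ := ⨆ (n : ℕ) (k : ℕ) (_ : 1 ≤ k) (_ : k ≤ n),
      ∫⁻ ω, ENNReal.ofReal ((deriv (p n k) (ε n k ω) / p n k (ε n k ω)) ^ 2) ∂P
  set M : ℝ≥0∞ := (⨆ (n : ℕ) (_ : 1 ≤ n), eLpNorm (X₀ n) 2 P) ^ 2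
  set C : ℝ≥0∞ := J / 8 * ENNReal.ofReal (σm⁻¹ ^ 2) * d * (ENNReal.ofReal (4 * σm ^ 2) + M)
    with hC
  have hCtop : C ≠ ∞ := by
    have h1 : M ≠ ∞ := ENNReal.pow_ne_top hA1.init_bounded.ne
    have h2 : J / 8 ≠ ∞ := ENNReal.div_ne_top hJ.ne (by norm_num)
    exact ENNReal.mul_ne_top (ENNReal.mul_ne_top (ENNReal.mul_ne_top h2 ENNReal.ofReal_ne_top)
      (ENNReal.natCast_ne_top d)) (ENNReal.add_ne_top.2 ⟨ENNReal.ofReal_ne_top, h1⟩)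
  have hceil : 1 ≤ ⌈β⌉₊ := Nat.one_le_ceil_iff.2 hβ
  obtain ⟨K, hK⟩ := TVAR.exists_holder_iteratedDeriv_bump (⌈β⌉₊ - 1)
    (a := β - ((⌈β⌉₊ - 1 : ℕ) : ℝ))
    (by rw [Nat.cast_sub hceil]; push_cast; linarith [Nat.ceil_lt_add_one hβ.le])
    (by rw [Nat.cast_sub hceil]; push_cast; linarith [Nat.le_ceil β])
  obtain ⟨τ, hτ, hτL, hτK, hτS, hτd, hτC⟩ : ∃ τ : ℝ, 0 < τ ∧ τ < L ∧ τ * K < L ∧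
      τ * ∑ j : Fin d, ρ⁻¹ ^ ((j : ℕ) + 1) < 1 ∧ τ ^ 2 * d < 1 / 4 ∧
      3 * τ ^ 2 * C.toReal < 1 / 2 := by
    have h : ∀ᶠ τ in nhdsWithin (0 : ℝ) (Set.Ioi 0), 0 < τ ∧ τ < L ∧ τ * K < L ∧
        τ * ∑ j : Fin d, ρ⁻¹ ^ ((j : ℕ) + 1) < 1 ∧ τ ^ 2 * d < 1 / 4 ∧
        3 * τ ^ 2 * C.toReal < 1 / 2 := by
      filter_upwards [self_mem_nhdsWithin,
        TVAR.eventually_lt_of_continuous (F := fun τ => τ) (B := L) (by fun_prop) hL,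
        TVAR.eventually_lt_of_continuous (F := fun τ => τ * K) (B := L) (by fun_prop) (by simpa),
        TVAR.eventually_lt_of_continuous (F := fun τ => τ * ∑ j : Fin d, ρ⁻¹ ^ ((j : ℕ) + 1))
          (B := 1) (by fun_prop) (by simp),
        TVAR.eventually_lt_of_continuous (F := fun τ => τ ^ 2 * d) (B := 1 / 4) (by fun_prop)
          (by simp),
        TVAR.eventually_lt_of_continuous (F := fun τ => 3 * τ ^ 2 * C.toReal) (B := 1 / 2)
          (by fun_prop) (by simp)] with τ h1 h2 h3 h4 h5 h6
      exact ⟨h1, h2, h3, h4, h5, h6⟩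
    exact h.exists
  -- The sum of the two risks is at least `(τ b ^ β)² / 16`, so the larger one is at least half of it.
  refine ⟨τ ^ 2 / 32, by positivity, fun n hn t _ δ hδ => le_iInf₂ fun u hu => ?_⟩
  obtain ⟨b, hb, hb1, hnb, hnb2, hbβ⟩ := TVAR.exists_bandwidth hβ hn
  rw [← hbβ]
  set c : ℝ := τ * b ^ β with hc
  set θ := TVAR.bumpCoeff β τ b t u with hθ
  have hθτ : ∀ s, ‖θ s‖ ≤ τ :=
    TVAR.norm_bumpCoeff_le_of_le_one hβ.le hτ.le hb hb1 t hu
  have hσmem : ∀ s ∈ Set.Icc (0 : ℝ) 1, σm ∈ Set.Icc σm σp := fun _ _ => ⟨le_rfl, hσ⟩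
  have hmem0 : ((0 : ℝ → EuclideanSpace ℝ (Fin d)), fun _ : ℝ => σm) ∈
      TVAR.ParamClass d β L ρ σm σp := by
    refine ⟨⟨?_, TVAR.mem_stableClass_of_norm_le hτ.le (fun _ => by simpa using hτ.le) hτS⟩, hσmem⟩
    -- The zero coefficient is the perturbation of height `0`.
    have h0 : (0 : ℝ → EuclideanSpace ℝ (Fin d)) = TVAR.bumpCoeff β 0 b t u := by
      ext s; simp [TVAR.bumpCoeff]
    rw [h0]
    exact TVAR.bumpCoeff_mem_lipBall hβ hK le_rfl hL.le (by simpa using hL.le) hb hb1 t hu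
  have hmem1 : (θ, fun _ : ℝ => σm) ∈ TVAR.ParamClass d β L ρ σm σp :=
    ⟨⟨TVAR.bumpCoeff_mem_lipBall hβ hK hτ.le hτL.le hτK.le hb hb1 t hu,
      TVAR.mem_stableClass_of_norm_le hτ.le hθτ hτS⟩, hσmem⟩
  set f : EuclideanSpace ℝ (Fin d) × (Fin n → ℝ) → ℝ := fun z => ∑ i, u i * δ z i with hf
  have hfm : Measurable f := Finset.measurable_fun_sum _ fun i _ =>
    ((TVAR.measurable_coord i).comp hδ).const_mul _
  have hu2 : ∑ i, u i * u i = 1 := by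
    have := EuclideanSpace.real_norm_sq_eq u
    rw [hu] at this
    simpa [sq] using this.symm
  set μ : Fin n → Measure ℝ := fun j => P.map (ε n (j + 1))
  set κ := P.map (X₀ n)
  have hmε : ∀ j : Fin n, Measurable (ε n (j + 1)) := fun j =>
    hA1.measurable_innov n _ (by omega) (by omega)
  have hmX : Measurable (X₀ n) := hA1.measurable_init n hn
  have : ∀ j, IsProbabilityMeasure (μ j) := fun j =>
    Measure.isProbabilityMeasure_map (hmε j).aemeasurable
  have : IsProbabilityMeasure κ := Measure.isProbabilityMeasure_map hmX.aemeasurable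
  have hpj : ∀ j : Fin n, _ := fun j => hp n (j + 1) (by omega) (by omega)
  have hT : ∑ j : Fin n, ENNReal.ofReal (‖θ ((j : ℕ) / n)‖ ^ 2) ≤ ENNReal.ofReal (3 * τ ^ 2) := by
    rw [← ENNReal.ofReal_sum_of_nonneg fun _ _ => sq_nonneg _]
    refine ENNReal.ofReal_le_ofReal ((TVAR.sum_norm_sq_bumpCoeff_le hn hτ.le hb hnb t hu).trans ?_)
    rw [mul_pow]
    exact le_of_eq (by linear_combination (3 * τ ^ 2) * hnb2)
  have hX : ∫⁻ x, ENNReal.ofReal (4 * σm ^ 2 + ‖x‖ ^ 2) ∂κ ≤ ENNReal.ofReal (4 * σm ^ 2) + M := by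
    simp_rw [fun x : EuclideanSpace ℝ (Fin d) => ENNReal.ofReal_add
      (by positivity : 0 ≤ 4 * σm ^ 2) (sq_nonneg ‖x‖)]
    rw [lintegral_add_left measurable_const, lintegral_const, measure_univ, mul_one]
    gcongr
    exact hA1.lintegral_init_sq_le hn
  have hsmall : (∑ j : Fin n, ENNReal.ofReal (‖θ ((j : ℕ) / n)‖ ^ 2)) *
      (J / 8 * ENNReal.ofReal (σm⁻¹ ^ 2) * d * ∫⁻ x, ENNReal.ofReal (4 * σm ^ 2 + ‖x‖ ^ 2) ∂κ) ≤
        ENNReal.ofReal (1 / 2) := by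
    calc _ ≤ ENNReal.ofReal (3 * τ ^ 2) * C := by rw [hC]; gcongr
      _ = ENNReal.ofReal (3 * τ ^ 2 * C.toReal) := by
        rw [ENNReal.ofReal_mul (by positivity : 0 ≤ 3 * τ ^ 2), ENNReal.ofReal_toReal hCtop]
      _ ≤ _ := ENNReal.ofReal_le_ofReal hτC.le
  have hrisk := TVAR.le_risk_add_risk (p := fun j => p n (j + 1)) (μ := μ) (J := J)
    (fun j => (hpj j).1) (fun j => (hpj j).2.2.1) (fun j => (hpj j).2.1)
    (fun j => by
      rw [TVAR.lintegral_fisherDensity_eq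
        (TVAR.continuous_of_absolutelyContinuousOnInterval (hpj j).2.2.1).measurable (hmε j)
        (hpj j).2.1]
      exact le_iSup₂_of_le n ((j : ℕ) + 1) (le_iSup₂_of_le (by omega) (by omega) le_rfl))
    (fun j => (hA1.lintegral_innov_sq (by omega) (by omega)).le)
    (θ := θ) (fun k _ => (mul_le_mul_of_nonneg_right
      (pow_le_pow_left₀ (norm_nonneg _) (hθτ _) 2) (Nat.cast_nonneg d)).trans hτd.le)
    hσm.ne' κ hsmall hfm c
  rw [← hA1.lintegral_sample hn 0 _ (hfm.pow_const 2).ennreal_ofReal,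
    ← hA1.lintegral_sample hn θ _ ((hfm.sub_const c).pow_const 2).ennreal_ofReal] at hrisk
  have hm0 : ∀ ω, ∑ i, u i * (δ (TVAR.sample 0 (fun _ => σm) n (X₀ n ω) fun k => ε n k ω) -
      (0 : ℝ → EuclideanSpace ℝ (Fin d)) t) i =
      f (TVAR.sample 0 (fun _ => σm) n (X₀ n ω) fun k => ε n k ω) := by
    intro ω; simp [hf]
  have hm1 : ∀ ω, ∑ i, u i * (δ (TVAR.sample θ (fun _ => σm) n (X₀ n ω) fun k => ε n k ω) -
      θ t) i = f (TVAR.sample θ (fun _ => σm) n (X₀ n ω) fun k => ε n k ω) - c := by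
    intro ω
    have h1 : ∑ i, u i * θ t i = c := by
      rw [hθ, TVAR.bumpCoeff_self]
      simp only [PiLp.smul_apply, smul_eq_mul, mul_left_comm, ← Finset.mul_sum, hu2, mul_one, hc]
    simp only [PiLp.sub_apply, mul_sub, Finset.sum_sub_distrib, h1, hf]
  have hle0 := le_iSup₂ (f := fun q (_ : q ∈ TVAR.ParamClass d β L ρ σm σp) => TVAR.msemForm P
    (fun ω => δ (TVAR.sample q.1 q.2 n (X₀ n ω) (fun k => ε n k ω)) - q.1 t) u) _ hmem0
  have hle1 := le_iSup₂ (f := fun q (_ : q ∈ TVAR.ParamClass d β L ρ σm σp) => TVAR.msemForm P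
    (fun ω => δ (TVAR.sample q.1 q.2 n (X₀ n ω) (fun k => ε n k ω)) - q.1 t) u) _ hmem1
  simp only [TVAR.msemForm, hm0] at hle0
  simp only [TVAR.msemForm, hm1] at hle1
  have hsum := hrisk.trans (add_le_add hle0 hle1)
  rw [← two_mul, show c ^ 2 / 16 = 2 * (τ ^ 2 / 32 * (b ^ β) ^ 2) by rw [hc]; ring,
    ENNReal.ofReal_mul two_pos.le, ENNReal.ofReal_ofNat] at hsum
  exact (ENNReal.mul_le_mul_iff_right (by norm_num) (by norm_num)).1 hsum
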